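/- Let $\Bbbk$ be an algebraically closed field (of any characteristic), let $Q=(Q_0,Q_1,t,h)$ be a finite quiver, and let $A=\Bbbk Q/I$, where $I$ is a two-sided ideal of the path algebra contained in the span of the paths of length at least $2$. For a dimension vector $\mathbf d\colon Q_0\to\mathbb Z_{\ge 0}$ let $\mathrm{rep}_A(\mathbf d)\subseteq \mathrm{rep}_Q(\mathbf d)=\prod_{\alpha\in Q_1}\mathrm{Mat}(\mathbf d(h\alpha),\mathbf d(t\alpha))$ be the closed subvariety of all $M$ that satisfy every relation in $I$, with the action of $GL(\mathbf d)=\prod_z GL(\mathbf d(z))$ given by $(g\cdot M)_\alpha=g_{h\alpha}M_\alpha g_{t\alpha}^{-1}$. Let $x\in Q_0$ be a node of $A$: every path of length $2$ with middle vertex $x$ lies in $I$ (sinks and sources are allowed). The split quiver $Q^x$ has vertex set $(Q_0\setminus\{x\})\cup\{x_t,x_h\}$ and the same arrows as $Q$, except that arrows with tail $x$ now have tail $x_t$ and arrows with head $x$ now have head $x_h$. Paths of positive length in $Q^x$ are paths of $Q$, so $\mathrm{rad}(\Bbbk Q^x)\subseteq\mathrm{rad}(\Bbbk Q)$, where $\mathrm{rad}$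 is the span of the paths of positive length; put $I^x=I\cap\mathrm{rad}(\Bbbk Q^x)$ and $A^x=\Bbbk Q^x/I^x$. Let $0\le r\le \mathbf d(x)$, and let $\mathbf d^x_r$ be the dimension vector of $Q^x$ with $\mathbf d^x_r(x_h)=r$, $\mathbf d^x_r(x_t)=\mathbf d(x)-r$, and equal to $\mathbf d$ at the other vertices. Embed $\mathrm{rep}_{A^x}(\mathbf d^x_r)$ into $\mathrm{rep}_A(\mathbf d)$ by replacing $M_\alpha$ with $\left[\begin{smallmatrix}M_\alpha\\0\end{smallmatrix}\right]$ if only the head of $\alpha$ is $x$, with $\left[\begin{smallmatrix}0&M_\alpha\end{smallmatrix}\right]$ if only the tail of $\alpha$ is $x$, with $\left[\begin{smallmatrix}0&M_\alpha\\0&0\end{smallmatrix}\right]$ if $\alpha$ is a loop at $x$, and leaving $M_\alpha$ unchanged otherwise. The $x$-rank $r_x(M)$ of $M\in\mathrm{rep}_A(\mathbf d)$ is the rank of the map $\bigoplus_{h\alpha=x}M_{t\alpha}\to M_x$ with components $M_\alpha$. Let $\mathrm{rep}_{A^x}(\mathbf d^x_r)^\circ$ be the set of points of $\mathrm{rep}_{A^x}(\mathbf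 d^x_r)$ whose $x$-rank is the maximum of the $x$-rank on $\mathrm{rep}_{A^x}(\mathbf d^x_r)$, and let $$\mathrm{rep}^r_A(\mathbf d)=\{N\in\mathrm{rep}_A(\mathbf d)\mid r_x(N)=r\}.$$ Let $P_r\le GL(\mathbf d(x))$ be the subgroup of block upper triangular matrices with diagonal blocks of sizes $r$ and $\mathbf d(x)-r$. For a $P_r$-stable locally closed subset $S$ of $\mathrm{rep}_A(\mathbf d)$ let $GL(\mathbf d(x))\times_{P_r}S$ be the quotient of the variety $GL(\mathbf d(x))\times S$ by the free action $p\cdot(g,M)=(gp^{-1},p\cdot M)$ of $P_r$, with the quotient topology and with the functions whose pull-backs to $GL(\mathbf d(x))\times S$ are regular as its regular functions. Then $\mathrm{rep}^r_A(\mathbf d)$ and $\mathrm{rep}_{A^x}(\mathbf d^x_r)^\circ$ are locally closed in $\mathrm{rep}_Q(\mathbf d)$, the latter is $P_r$-stable, and if $\mathrm{rep}^r_A(\mathbf d)$ is non-empty, then $$\Psi\colon GL(\mathbf d(x))\times_{P_r}\mathrm{rep}_{A^x}(\mathbf d^x_r)^\circ\longrightarrow \mathrm{rep}^r_A(\mathbf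 d),\qquad (g,M)\mapsto g\cdot M,$$ is well defined and an isomorphism of varieties. -/

import Mathlib

universe u v w

noncomputable section

namespace NodeSplitting

/-! ## Path algebras of quivers -/

/-- Paths of a quiver (including the trivial paths), with their source and target. -/
abbrev AnyPath (V : Type u) [Quiver.{v} V] := Σ a b : V, Quiver.Path a b

/-- The path algebra of a quiver over `k`: the vector space with the paths as a basis. -/
def PathAlgebra (k : Type w) [Field k] (V : Type u) [Quiver.{v} V] := AnyPath V →₀ k

section PathAlgebra

variable (k : Type w) [Field k] (V : Type u) [Quiver.{v} V]

instance : AddCommGroup (PathAlgebra k V) := inferInstanceAs (AddCommGroup (AnyPath V →₀ k))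

instance : Module k (PathAlgebra k V) := inferInstanceAs (Module k (AnyPath V →₀ k))

variable {V}

/-- The basis element given by a path. -/
def ofPath (p : AnyPath V) : PathAlgebra k V := Finsupp.single p 1

variable {k}

/-- The coordinates of an element in the basis of paths. -/
def coeffs : PathAlgebra k V ≃ₗ[k] (AnyPath V →₀ k) := LinearEquiv.refl k _

variable {M : Type*} [AddCommGroup M] [Module k M]

/-- The linear map with prescribed values on paths. -/
def lift (f : AnyPath V → M) : PathAlgebra k V →ₗ[k] M :=
  Finsupp.linearCombination k f ∘ₗ coeffs.toLinearMap

@[simp] theorem lift_ofPath (f : AnyPath V → M) (p : AnyPath V) :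
    lift f (ofPath k p) = f p :=
  (Finsupp.linearCombination_single k 1 p).trans (one_smul k _)

theorem hom_ext {f g : PathAlgebra k V →ₗ[k] M}
    (h : ∀ p, f (ofPath k p) = g (ofPath k p)) : f = g :=
  Finsupp.lhom_ext' fun p => LinearMap.ext_ring (h p)

theorem elemInduction {P : PathAlgebra k V → Prop} (a : PathAlgebra k V) (zero : P 0)
    (add : ∀ a b, P a → P b → P (a + b)) (smul : ∀ (t : k) (p : AnyPath V), P (t • ofPath k p)) :
    P a := by
  refine Finsupp.induction_linear (motive := P) a zero (fun a b => add a b) fun p t => ?_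
  have h : (Finsupp.single p t : AnyPath V →₀ k) = t • Finsupp.single p 1 := by simp
  rw [h]
  exact smul t p

variable (k) in
open Classical in
/-- The product of two paths: `q` followed by `p` if `q` ends where `p` starts, else `0`. -/
def pathMul (p q : AnyPath V) : PathAlgebra k V :=
  if h : q.2.1 = p.1 then ofPath k ⟨q.1, p.2.1, (q.2.2.cast rfl h).comp p.2.2⟩ else 0

theorem pathMul_comp {a b c : V} (q : Quiver.Path a b) (p : Quiver.Path b c) :
    pathMul k ⟨b, c, p⟩ ⟨a, b, q⟩ = ofPath k ⟨a, c, q.comp p⟩ := by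
  simp [pathMul]

theorem pathMul_ne {p q : AnyPath V} (h : q.2.1 ≠ p.1) : pathMul k p q = 0 := by
  simp [pathMul, h]

/-- The multiplication of the path algebra as a bilinear map. -/
def mulBilin : PathAlgebra k V →ₗ[k] PathAlgebra k V →ₗ[k] PathAlgebra k V :=
  lift fun p => lift fun q => pathMul k p q

instance : Mul (PathAlgebra k V) := ⟨fun a b => mulBilin a b⟩

theorem mul_def (a b : PathAlgebra k V) : a * b = mulBilin a b := rfl

@[simp] theorem ofPath_mul_ofPath (p q : AnyPath V) :
    ofPath k p * ofPath k q = pathMul k p q := by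
  simp [mul_def, mulBilin]

theorem pathMul_assoc (p q s : AnyPath V) :
    mulBilin (pathMul k p q) (ofPath k s) = mulBilin (ofPath k p) (pathMul k q s) := by
  obtain ⟨a, b, p⟩ := p
  obtain ⟨c, e, q⟩ := q
  obtain ⟨f, g, s⟩ := s
  by_cases h1 : e = a
  · subst h1
    by_cases h2 : g = c
    · subst h2
      simp only [pathMul_comp, ← mul_def, ofPath_mul_ofPath, Quiver.Path.comp_assoc]
    · rw [pathMul_comp, pathMul_ne (p := ⟨c, e, q⟩) (by simpa using h2)]
      simp only [← mul_def, ofPath_mul_ofPath]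
      rw [pathMul_ne (by simpa using h2)]
      simp [mul_def]
  · rw [pathMul_ne (p := ⟨a, b, p⟩) (by simpa using h1)]
    by_cases h2 : g = c
    · subst h2
      rw [pathMul_comp]
      simp only [← mul_def, ofPath_mul_ofPath]
      rw [pathMul_ne (by simpa using h1)]
      simp [mul_def]
    · rw [pathMul_ne (p := ⟨c, e, q⟩) (by simpa using h2)]
      simp

instance [Fintype V] : One (PathAlgebra k V) :=
  ⟨∑ a : V, ofPath k ⟨a, a, Quiver.Path.nil⟩⟩

theorem one_def [Fintype V] :
    (1 : PathAlgebra k V) = ∑ a : V, ofPath k ⟨a, a, Quiver.Path.nil⟩ := rfl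

instance [Fintype V] : Ring (PathAlgebra k V) where
  __ := (inferInstance : AddCommGroup (PathAlgebra k V))
  left_distrib a b c := by simp [mul_def]
  right_distrib a b c := by simp [mul_def]
  zero_mul a := by simp [mul_def]
  mul_zero a := by simp [mul_def]
  mul_assoc a b c := by
    induction a using elemInduction with
    | zero => simp [mul_def]
    | add a a' ha ha' => simp only [mul_def, map_add, LinearMap.add_apply] at *; rw [ha, ha']
    | smul t p =>
      induction b using elemInduction with
      | zero => simp [mul_def]
      | add a a' ha ha' => simp only [mul_def, map_add, LinearMap.add_apply] at *; rw [ha, ha']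
      | smul t' q =>
        induction c using elemInduction with
        | zero => simp [mul_def]
        | add a a' ha ha' => simp only [mul_def, map_add] at *; rw [ha, ha']
        | smul t'' s =>
          simp only [mul_def, map_smul, LinearMap.smul_apply]
          simp only [← mul_def, ofPath_mul_ofPath]
          simp only [mul_def, pathMul_assoc]
  one_mul a := by
    have h : mulBilin (1 : PathAlgebra k V) = LinearMap.id := by
      refine hom_ext fun p => ?_
      obtain ⟨a, b, p⟩ := p
      rw [one_def, map_sum, LinearMap.sum_apply, Finset.sum_eq_single b]
      · simp [← mul_def, pathMul_comp]
      · intro c _ hc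
        simp only [← mul_def, ofPath_mul_ofPath]
        exact pathMul_ne (by simpa using hc.symm)
      · simp
    simp [mul_def, h]
  mul_one a := by
    have h : mulBilin.flip (1 : PathAlgebra k V) = LinearMap.id := by
      refine hom_ext fun p => ?_
      obtain ⟨a, b, p⟩ := p
      rw [one_def, map_sum, LinearMap.sum_apply, Finset.sum_eq_single a]
      · simp [← mul_def, pathMul_comp]
      · intro c _ hc
        simp only [← mul_def, ofPath_mul_ofPath, LinearMap.flip_apply]
        exact pathMul_ne (by simpa using hc)
      · simp
    exact congrArg (fun f => f a) h
  zsmul := fun n a => n • a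
  zsmul_zero' := fun a => zero_zsmul a
  zsmul_succ' := fun n a => SubNegMonoid.zsmul_succ' n a
  zsmul_neg' := fun n a => SubNegMonoid.zsmul_neg' n a
  nsmul := fun n a => n • a
  nsmul_zero := fun a => zero_nsmul a
  nsmul_succ := fun n a => AddMonoid.nsmul_succ n a

theorem smul_mem_ideal [Fintype V] (I : TwoSidedIdeal (PathAlgebra k V)) (t : k)
    {a : PathAlgebra k V} (ha : a ∈ I) : t • a ∈ I := by
  have h : t • a = (t • (1 : PathAlgebra k V)) * a := by
    rw [mul_def, map_smul, LinearMap.smul_apply, ← mul_def, one_mul]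
  rw [h]
  exact I.mul_mem_left _ _ ha

variable (k V) in
/-- The `n`-th power of the arrow ideal `rad (kQ)`: the span of the paths of length at
least `n`. -/
def radPow (n : ℕ) : Submodule k (PathAlgebra k V) :=
  Submodule.span k {a | ∃ p : AnyPath V, n ≤ p.2.2.length ∧ a = ofPath k p}

/-- `x` is a node of `kQ / I`: any composite of an arrow with head `x` and an arrow with tail `x`
lies in `I`. Sinks and sources are allowed. -/
def IsNode [Fintype V] (I : TwoSidedIdeal (PathAlgebra k V)) (x : V) : Prop :=
  ∀ (y z : V) (f : y ⟶ x) (g : x ⟶ z), ofPath k ⟨y, z, f.toPath.comp g.toPath⟩ ∈ I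

end PathAlgebra

/-! ## Node splitting -/

/-- The vertex set `(Q₀ \ {x}) ∪ {x_t, x_h}` of the split quiver `Q^x`. -/
inductive SplitVertex {V : Type u} (x : V) : Type u
  | old (z : V) (hz : z ≠ x) : SplitVertex x
  | tail : SplitVertex x
  | head : SplitVertex x

namespace SplitVertex

section

variable {V : Type u} {x : V}

/-- The map on vertices that sends `x_t` and `x_h` back to `x`. -/
def proj : SplitVertex x → V
  | old z _ => z
  | tail => x
  | head => x

variable (x) in
/-- The vertex of `Q^x` at which an arrow of `Q` with tail `a` starts. -/
def asTail [DecidableEq V] (a : V) : SplitVertex x := if h : a = x then tail else old a h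

variable (x) in
/-- The vertex of `Q^x` at which an arrow of `Q` with head `b` ends. -/
def asHead [DecidableEq V] (b : V) : SplitVertex x := if h : b = x then head else old b h

theorem proj_asTail [DecidableEq V] (a : V) : (asTail x a).proj = a := by
  unfold asTail; split_ifs with h
  · exact h.symm
  · rfl

theorem proj_asHead [DecidableEq V] (a : V) : (asHead x a).proj = a := by
  unfold asHead; split_ifs with h
  · exact h.symm
  · rfl

theorem asTail_ne_head [DecidableEq V] (a : V) : asTail x a ≠ head := by
  unfold asTail; split_ifs <;> simp

theorem asHead_ne_tail [DecidableEq V] (a : V) : asHead x a ≠ tail := by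
  unfold asHead; split_ifs <;> simp

theorem proj_inj_of_ne_tail {a b : SplitVertex x} (ha : a ≠ tail) (hb : b ≠ tail)
    (h : a.proj = b.proj) : a = b := by
  cases a <;> cases b <;> simp_all [proj]; exact absurd h.symm ‹_›

theorem proj_inj_of_ne_head {a b : SplitVertex x} (ha : a ≠ head) (hb : b ≠ head)
    (h : a.proj = b.proj) : a = b := by
  cases a <;> cases b <;> simp_all [proj]; exact absurd h.symm ‹_›

instance [DecidableEq V] : DecidableEq (SplitVertex x) := Classical.decEq _

instance [Fintype V] : Fintype (SplitVertex x) :=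
  have : Finite (SplitVertex x) := by
    refine Finite.of_injective (β := Option (Option V)) (fun a => match a with
      | old z _ => some (some z)
      | tail => some none
      | head => none) ?_
    intro a b h
    cases a <;> cases b <;> simp_all
  Fintype.ofFinite _

/-- The split quiver `Q^x`: it has the same arrows as `Q`; an arrow with tail `x` now starts at
`x_t` (so no arrow starts at `x_h`), and an arrow with head `x` now ends at `x_h` (so no arrow
ends at `x_t`). -/
instance [Quiver.{v} V] : Quiver.{v} (SplitVertex x) where
  Hom a b := {_f : a.proj ⟶ b.proj // a ≠ head ∧ b ≠ tail}

variable [Quiver.{v} V]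

/-- The arrow of `Q^x` given by an arrow of `Q`. -/
def arrow [DecidableEq V] {a b : V} (f : a ⟶ b) : asTail x a ⟶ asHead x b :=
  ⟨f.cast (proj_asTail a).symm (proj_asHead b).symm, asTail_ne_head a, asHead_ne_tail b⟩

variable (x) in
/-- The map of quivers from `Q^x` to `Q` that glues `x_t` and `x_h`. -/
def glue : SplitVertex x ⥤q V where
  obj := proj
  map f := f.1

/-- A path of `Q^x` regarded as a path of `Q`. -/
def gluePath (p : AnyPath (SplitVertex x)) : AnyPath V :=
  ⟨p.1.proj, p.2.1.proj, (glue x).mapPath p.2.2⟩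

theorem target_ne_tail (p : AnyPath (SplitVertex x)) (hp : 1 ≤ p.2.2.length) : p.2.1 ≠ tail := by
  obtain ⟨a, b, p⟩ := p
  cases p with
  | nil => simp at hp
  | cons p f => exact f.2.2

theorem source_ne_head (p : AnyPath (SplitVertex x)) (hp : 1 ≤ p.2.2.length) : p.1 ≠ head := by
  obtain ⟨a, b, p⟩ := p
  induction p with
  | nil => simp at hp
  | cons p f ih =>
    cases p with
    | nil => exact f.2.1
    | cons p g => exact ih (by simp)

variable (k : Type w) [Field k]

/-- The linear map from `k Q^x` to `k Q` that regards paths of `Q^x` as paths of `Q`; on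
`rad (k Q^x)` it is the inclusion `rad (k Q^x) ⊆ rad (k Q)`. -/
def glueLinear : PathAlgebra k (SplitVertex x) →ₗ[k] PathAlgebra k V :=
  lift fun p => ofPath k (gluePath p)

variable {k}

theorem glueLinear_pathMul {p q : AnyPath (SplitVertex x)}
    (h : q.2.1.proj = p.1.proj → q.2.1 = p.1) :
    glueLinear k (pathMul k p q) = pathMul k (gluePath p) (gluePath q) := by
  obtain ⟨a, b, p⟩ := p
  obtain ⟨c, e, q⟩ := q
  by_cases h1 : e = a
  · subst h1
    simp only [pathMul_comp, gluePath, glueLinear, lift_ofPath]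
    erw [pathMul_comp]
    rw [Prefunctor.mapPath_comp]
    rfl
  · rw [pathMul_ne (by simpa using h1), pathMul_ne]
    · simp
    · exact fun h2 => h1 (h h2)

theorem pathMul_mem_radPow {p q : AnyPath V} (h : 1 ≤ p.2.2.length ∨ 1 ≤ q.2.2.length) :
    pathMul k p q ∈ radPow k V 1 := by
  obtain ⟨a, b, p⟩ := p
  obtain ⟨c, e, q⟩ := q
  by_cases h1 : e = a
  · subst h1
    rw [pathMul_comp]
    refine Submodule.subset_span ⟨_, ?_, rfl⟩
    simp only [Quiver.Path.length_comp] at *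
    omega
  · rw [pathMul_ne (by simpa using h1)]
    exact Submodule.zero_mem _

variable [Fintype V]

theorem ofPath_mul_mem (I : TwoSidedIdeal (PathAlgebra k V)) (q : AnyPath (SplitVertex x))
    {a : PathAlgebra k (SplitVertex x)} (ha : a ∈ radPow k (SplitVertex x) 1)
    (hI : glueLinear k a ∈ I) :
    ofPath k q * a ∈ radPow k (SplitVertex x) 1 ∧ glueLinear k (ofPath k q * a) ∈ I := by
  constructor
  · clear hI
    induction ha using Submodule.span_induction with
    | mem a h =>
      obtain ⟨p, hp, rfl⟩ := h
      rw [ofPath_mul_ofPath]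
      exact pathMul_mem_radPow (.inr hp)
    | zero => simp
    | add a b _ _ h1 h2 => rw [mul_add]; exact Submodule.add_mem _ h1 h2
    | smul t a _ h =>
      rw [mul_def, map_smul]
      exact Submodule.smul_mem _ _ h
  · by_cases hq : q.1 = tail
    · have h : ofPath k q * a = 0 := by
        clear hI
        induction ha using Submodule.span_induction with
        | mem a h =>
          obtain ⟨p, hp, rfl⟩ := h
          rw [ofPath_mul_ofPath]
          exact pathMul_ne fun h => target_ne_tail p hp (h.trans hq)
        | zero => simp
        | add a b _ _ h1 h2 => rw [mul_add, h1, h2, add_zero]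
        | smul t a _ h => rw [mul_def, map_smul, ← mul_def, h, smul_zero]
      rw [h, map_zero]
      exact I.zero_mem
    · have h : glueLinear k (ofPath k q * a) = ofPath k (gluePath q) * glueLinear k a := by
        clear hI
        induction ha using Submodule.span_induction with
        | mem a h =>
          obtain ⟨p, hp, rfl⟩ := h
          rw [ofPath_mul_ofPath,
            glueLinear_pathMul fun h => proj_inj_of_ne_tail (target_ne_tail p hp) hq h]
          simp [glueLinear]
        | zero => simp
        | add a b _ _ h1 h2 => rw [mul_add, map_add, h1, h2, map_add, mul_add]
        | smul t a _ h =>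
          simp only [mul_def, map_smul] at *
          rw [h]
      rw [h]
      exact I.mul_mem_left _ _ hI

theorem mul_ofPath_mem (I : TwoSidedIdeal (PathAlgebra k V)) (q : AnyPath (SplitVertex x))
    {a : PathAlgebra k (SplitVertex x)} (ha : a ∈ radPow k (SplitVertex x) 1)
    (hI : glueLinear k a ∈ I) :
    a * ofPath k q ∈ radPow k (SplitVertex x) 1 ∧ glueLinear k (a * ofPath k q) ∈ I := by
  constructor
  · clear hI
    induction ha using Submodule.span_induction with
    | mem a h =>
      obtain ⟨p, hp, rfl⟩ := h
      rw [ofPath_mul_ofPath]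
      exact pathMul_mem_radPow (.inl hp)
    | zero => simp
    | add a b _ _ h1 h2 => rw [add_mul]; exact Submodule.add_mem _ h1 h2
    | smul t a _ h =>
      rw [mul_def, map_smul]
      exact Submodule.smul_mem _ _ h
  · by_cases hq : q.2.1 = head
    · have h : a * ofPath k q = 0 := by
        clear hI
        induction ha using Submodule.span_induction with
        | mem a h =>
          obtain ⟨p, hp, rfl⟩ := h
          rw [ofPath_mul_ofPath]
          exact pathMul_ne fun h => source_ne_head p hp (h.symm.trans hq)
        | zero => simp
        | add a b _ _ h1 h2 => rw [add_mul, h1, h2, add_zero]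
        | smul t a _ h =>
          rw [mul_def, map_smul, LinearMap.smul_apply, ← mul_def, h, smul_zero]
      rw [h, map_zero]
      exact I.zero_mem
    · have h : glueLinear k (a * ofPath k q) = glueLinear k a * ofPath k (gluePath q) := by
        clear hI
        induction ha using Submodule.span_induction with
        | mem a h =>
          obtain ⟨p, hp, rfl⟩ := h
          rw [ofPath_mul_ofPath,
            glueLinear_pathMul fun h => proj_inj_of_ne_head hq (source_ne_head p hp) h]
          simp [glueLinear]
        | zero => simp
        | add a b _ _ h1 h2 => rw [add_mul, map_add, h1, h2, map_add, add_mul]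
        | smul t a _ h =>
          simp only [mul_def, map_smul, LinearMap.smul_apply] at *
          rw [h]
      rw [h]
      exact I.mul_mem_right _ _ hI

/-- The ideal `I^x = I ∩ rad (k Q^x)` of `k Q^x`, so that `A^x = k Q^x / I^x`. -/
def splitIdeal (I : TwoSidedIdeal (PathAlgebra k V)) (x : V) :
    TwoSidedIdeal (PathAlgebra k (SplitVertex x)) :=
  TwoSidedIdeal.mk' {a | a ∈ radPow k (SplitVertex x) 1 ∧ glueLinear k a ∈ I}
    ⟨Submodule.zero_mem _, by rw [map_zero]; exact I.zero_mem⟩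
    (fun ha hb => ⟨Submodule.add_mem _ ha.1 hb.1, by
      rw [map_add]; exact I.add_mem ha.2 hb.2⟩)
    (fun ha => ⟨Submodule.neg_mem _ ha.1, by rw [map_neg]; exact I.neg_mem ha.2⟩)
    (fun {b a} ha => by
      induction b using elemInduction with
      | zero => simp
      | add b c hb hc =>
        refine ⟨?_, ?_⟩
        · rw [add_mul]; exact Submodule.add_mem _ hb.1 hc.1
        · rw [add_mul, map_add]; exact I.add_mem hb.2 hc.2
      | smul t q =>
        have h := ofPath_mul_mem I q ha.1 ha.2
        have h' : (t • ofPath k q) * a = t • (ofPath k q * a) := by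
          simp only [mul_def, map_smul, LinearMap.smul_apply]
        rw [h']
        exact ⟨Submodule.smul_mem _ _ h.1, by rw [map_smul]; exact smul_mem_ideal I t h.2⟩)
    (fun {a b} ha => by
      induction b using elemInduction with
      | zero => simp
      | add b c hb hc =>
        refine ⟨?_, ?_⟩
        · rw [mul_add]; exact Submodule.add_mem _ hb.1 hc.1
        · rw [mul_add, map_add]; exact I.add_mem hb.2 hc.2
      | smul t q =>
        have h := mul_ofPath_mem I q ha.1 ha.2
        have h' : a * (t • ofPath k q) = t • (a * ofPath k q) := by
          simp only [mul_def, map_smul]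
        rw [h']
        exact ⟨Submodule.smul_mem _ _ h.1, by rw [map_smul]; exact smul_mem_ideal I t h.2⟩)

end

end SplitVertex

/-! ## Representation varieties -/

section Representations

variable {k : Type w} [Field k] {V : Type u} [Quiver.{v} V]

variable (k) in
/-- The points of `rep_Q(d)`: a `d(hα) × d(tα)` matrix for each arrow `α`. -/
abbrev RepSpace (d : V → ℕ) := ∀ a b : V, (a ⟶ b) → Matrix (Fin (d b)) (Fin (d a)) k

variable {d : V → ℕ}

/-- The matrix by which a path acts in a representation. -/
def pathMatrix (M : RepSpace k d) {a : V} :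
    ∀ {b : V}, Quiver.Path a b → Matrix (Fin (d b)) (Fin (d a)) k
  | _, .nil => 1
  | _, .cons p f => M _ _ f * pathMatrix M p

/-- The action of the path algebra on the total space `⨁_z k^{d(z)}` of a representation. -/
def evalRep [DecidableEq V] (M : RepSpace k d) :
    PathAlgebra k V →ₗ[k] (∀ z, Fin (d z) → k) →ₗ[k] (∀ z, Fin (d z) → k) :=
  lift fun p => LinearMap.single k (fun z => Fin (d z) → k) p.2.1 ∘ₗ
    (pathMatrix M p.2.2).mulVecLin ∘ₗ LinearMap.proj p.1

/-- The representation variety `rep_A(d)`, for `A = kQ / I`. -/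
def repVariety [DecidableEq V] [Fintype V] (I : TwoSidedIdeal (PathAlgebra k V)) (d : V → ℕ) :
    Set (RepSpace k d) :=
  {M | ∀ a ∈ I, evalRep M a = 0}

/-- The action of the base change group `GL(d) = ∏_z GL(d(z))` on `rep_Q(d)`. -/
def baseChange (g : ∀ z, GL (Fin (d z)) k) (M : RepSpace k d) : RepSpace k d :=
  fun a b f => (g b).val * M a b f * (g a)⁻¹.val

theorem baseChange_one (M : RepSpace k d) : baseChange 1 M = M := by
  funext a b f; simp [baseChange]

theorem baseChange_mul (g g' : ∀ z, GL (Fin (d z)) k) (M : RepSpace k d) :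
    baseChange (g * g') M = baseChange g (baseChange g' M) := by
  funext a b f; simp [baseChange, Matrix.mul_assoc]

/-- The action of the factor `GL(d(x))` of `GL(d)`. -/
def vertexAct [DecidableEq V] (x : V) (g : GL (Fin (d x)) k) (M : RepSpace k d) : RepSpace k d :=
  baseChange (Pi.mulSingle x g) M

theorem vertexAct_one [DecidableEq V] (x : V) (M : RepSpace k d) : vertexAct x 1 M = M := by
  simp [vertexAct, baseChange_one]

theorem vertexAct_mul [DecidableEq V] (x : V) (g g' : GL (Fin (d x)) k) (M : RepSpace k d) :
    vertexAct x (g * g') M = vertexAct x g (vertexAct x g' M) := by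
  simp [vertexAct, Pi.mulSingle_mul, baseChange_mul]

section Rank

variable [Fintype V] [∀ a b : V, Fintype (a ⟶ b)]

/-- The map `h_x(M) : ⨁_{hα = x} M_{tα} → M_x`. -/
def headMap (M : RepSpace k d) (x : V) :
    (∀ α : Σ a : V, (a ⟶ x), Fin (d α.1) → k) →ₗ[k] (Fin (d x) → k) :=
  ∑ α : Σ a : V, (a ⟶ x), (M α.1 x α.2).mulVecLin ∘ₗ LinearMap.proj α

/-- The `x`-rank of a single representation. -/
def xRank (x : V) (M : RepSpace k d) : ℕ := Module.finrank k (LinearMap.range (headMap M x))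

/-- The `x`-rank of a set of representations: the maximum of the `x`-ranks of its elements
(they are all at most `d(x)`). -/
def xRankSet (x : V) (S : Set (RepSpace k d)) : ℕ := sSup (xRank x '' S)

/-- The locus `S°` of maximal `x`-rank in `S`. -/
def maxRankLocus (x : V) (S : Set (RepSpace k d)) : Set (RepSpace k d) :=
  {M | M ∈ S ∧ xRank x M = xRankSet x S}

/-- The locus `rep^r_A(d)` of points of `x`-rank exactly `r` in `rep_A(d)`. -/
def rankStratum [DecidableEq V] (I : TwoSidedIdeal (PathAlgebra k V)) (d : V → ℕ) (x : V) (r : ℕ) :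
    Set (RepSpace k d) :=
  {N | N ∈ repVariety I d ∧ xRank x N = r}

end Rank

/-- The dimension vector `d^x_r` of the split quiver. -/
def splitDim (d : V → ℕ) (x : V) (r : ℕ) : SplitVertex x → ℕ
  | .old z _ => d z
  | .tail => d x - r
  | .head => r

/-- The position in `k^{d(x)}` at which the block of a vertex of `Q^x` starts: the block of `x_h`
consists of the first `r` coordinates, the block of `x_t` of the last `d(x) - r`. -/
def blockStart {x : V} (r : ℕ) : SplitVertex x → ℕ
  | .old _ _ => 0
  | .tail => r
  | .head => 0

variable (k) in
/-- The `0/1` matrix of the inclusion of the block of a vertex `z'` of `Q^x` into `k^{d(z)}`, where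
`z` is the vertex of `Q` under `z'`. It is the identity if `z' ≠ x_t, x_h`. -/
def blockIncl (d : V → ℕ) {x : V} (r : ℕ) (z : V) (z' : SplitVertex x) :
    Matrix (Fin (d z)) (Fin (splitDim d x r z')) k :=
  Matrix.of fun i j => if i.val = blockStart r z' + j.val then 1 else 0

/-- The embedding `i : rep_{Q^x}(d^x_r) → rep_Q(d)` by block matrices: `M_α` becomes
`[M_α; 0]` if only the head of `α` is `x`, `[0 M_α]` if only the tail is `x`, and
`[0 M_α; 0 0]` if `α` is a loop at `x`. -/
def splitEmbedding [DecidableEq V] (d : V → ℕ) (x : V) (r : ℕ) (M : RepSpace k (splitDim d x r)) :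
    RepSpace k d :=
  fun a b f => blockIncl k d r b (SplitVertex.asHead x b) * M _ _ (SplitVertex.arrow f) *
    (blockIncl k d r a (SplitVertex.asTail x a)).transpose

/-- The variety `rep_{A^x}(d^x_r)`, embedded into `rep_Q(d)`. -/
def splitRepVariety [DecidableEq V] [Fintype V] (I : TwoSidedIdeal (PathAlgebra k V)) (d : V → ℕ)
    (x : V) (r : ℕ) : Set (RepSpace k d) :=
  splitEmbedding d x r '' repVariety (SplitVertex.splitIdeal I x) (splitDim d x r)

variable (k) in
/-- The parabolic subgroup `P_r ≤ GL_n` of block upper triangular matrices with diagonal blocks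
of sizes `r` and `n - r`. -/
def parabolic (n r : ℕ) : Subgroup (GL (Fin n) k) where
  carrier := {g | (g : Matrix (Fin n) (Fin n) k).BlockTriangular fun i => decide (r ≤ i.val)}
  mul_mem' ha hb := by
    simpa using Matrix.BlockTriangular.mul ha hb
  one_mem' := by
    simpa using Matrix.blockTriangular_one
  inv_mem' {g} hg := by
    have : Invertible (g : Matrix (Fin n) (Fin n) k) := g.invertible
    simpa using Matrix.blockTriangular_inv_of_blockTriangular hg

end Representations

/-! ## Varieties as spaces with functions -/

section Spaces

/-- A topological space with a sheaf of `k`-valued functions. -/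
structure FunctionedSpace (k : Type w) [Field k] where
  carrier : Type u
  [top : TopologicalSpace carrier]
  regular (U : TopologicalSpace.Opens carrier) : Subalgebra k (U → k)
  restrict {U U' : TopologicalSpace.Opens carrier} (h : U' ≤ U) (f : U → k) (hf : f ∈ regular U) :
    (fun y : U' => f ⟨y, h y.2⟩) ∈ regular U'
  glue (U : TopologicalSpace.Opens carrier) (f : U → k)
    (hf : ∀ y : U, ∃ (U' : TopologicalSpace.Opens carrier) (h : U' ≤ U),
      y.1 ∈ U' ∧ (fun z : U' => f ⟨z, h z.2⟩) ∈ regular U') : f ∈ regular U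

attribute [instance] FunctionedSpace.top

variable {k : Type w} [Field k]

/-- Morphisms of spaces with functions: continuous maps that pull regular functions back to regular
functions. Between varieties these are the morphisms of varieties. -/
def IsMorphism (X Y : FunctionedSpace k) (φ : X.carrier → Y.carrier) : Prop :=
  ∃ hφ : Continuous φ, ∀ (U : TopologicalSpace.Opens Y.carrier) (f : U → k), f ∈ Y.regular U →
    (fun y : TopologicalSpace.Opens.comap ⟨φ, hφ⟩ U => f ⟨φ y, y.2⟩) ∈
      X.regular (TopologicalSpace.Opens.comap ⟨φ, hφ⟩ U)

/-- Isomorphisms: morphisms with an inverse morphism. -/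
def IsIsomorphism (X Y : FunctionedSpace k) (φ : X.carrier → Y.carrier) : Prop :=
  IsMorphism X Y φ ∧ ∃ ψ : Y.carrier → X.carrier,
    IsMorphism Y X ψ ∧ Function.LeftInverse ψ φ ∧ Function.RightInverse ψ φ

variable (k) in
/-- The polynomial functions on a vector space. -/
def polyFun (W : Type u) [AddCommGroup W] [Module k W] : Subalgebra k (W → k) :=
  Algebra.adjoin k {f | ∃ l : W →ₗ[k] k, f = l}

variable (k) in
/-- The Zariski topology on a vector space: a basis of open sets is given by the non-vanishing loci
of polynomial functions. -/
@[reducible] def zariski (W : Type u) [AddCommGroup W] [Module k W] : TopologicalSpace W :=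
  TopologicalSpace.generateFrom {U | ∃ p ∈ polyFun k W, U = {y | p y ≠ 0}}

variable (k) in
/-- Locally closed subsets for the Zariski topology. -/
def IsZariskiLocallyClosed {W : Type u} [AddCommGroup W] [Module k W] (S : Set W) : Prop :=
  @IsLocallyClosed W (zariski k W) S

/-- For an injective map `ι` from `T` onto a locally closed subset of a finite-dimensional vector
space `W`, the set `T` with the structure of a (quasi-affine) variety that it has as a subset of
`W`: it carries the Zariski topology, and regular functions are locally quotients of polynomial
functions. -/
def subvariety {T : Type v} {W : Type u} [AddCommGroup W] [Module k W] (ι : T → W) :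
    FunctionedSpace.{v, w} k :=
  letI : TopologicalSpace T := (zariski k W).induced ι
  { carrier := T
    regular := fun U =>
      { carrier := {f | ∀ y : U, ∃ U' : TopologicalSpace.Opens T, y.1 ∈ U' ∧
          ∃ p ∈ polyFun k W, ∃ q ∈ polyFun k W, ∀ z : U, z.1 ∈ U' →
            q (ι z) ≠ 0 ∧ f z = p (ι z) / q (ι z)}
        mul_mem' := by
          intro f g hf hg y
          obtain ⟨A, hA, p, hp, q, hq, h⟩ := hf y
          obtain ⟨B, hB, p', hp', q', hq', h'⟩ := hg y
          refine ⟨A ⊓ B, ⟨hA, hB⟩, p * p', mul_mem hp hp', q * q', mul_mem hq hq', fun z hz => ?_⟩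
          obtain ⟨h1, h2⟩ := h z hz.1
          obtain ⟨h3, h4⟩ := h' z hz.2
          refine ⟨mul_ne_zero h1 h3, ?_⟩
          simp only [Pi.mul_apply, h2, h4]
          field_simp
        add_mem' := by
          intro f g hf hg y
          obtain ⟨A, hA, p, hp, q, hq, h⟩ := hf y
          obtain ⟨B, hB, p', hp', q', hq', h'⟩ := hg y
          refine ⟨A ⊓ B, ⟨hA, hB⟩, p * q' + p' * q, add_mem (mul_mem hp hq') (mul_mem hp' hq),
            q * q', mul_mem hq hq', fun z hz => ?_⟩
          obtain ⟨h1, h2⟩ := h z hz.1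
          obtain ⟨h3, h4⟩ := h' z hz.2
          refine ⟨mul_ne_zero h1 h3, ?_⟩
          simp only [Pi.mul_apply, Pi.add_apply, h2, h4]
          field_simp
        algebraMap_mem' := fun c y =>
          ⟨⊤, trivial, algebraMap k _ c, Subalgebra.algebraMap_mem _ c, 1, one_mem _,
            fun z _ => by simp⟩ }
    restrict := by
      intro U A h f hf y
      obtain ⟨B, hB, p, hp, q, hq, h'⟩ := hf ⟨y, h y.2⟩
      exact ⟨B, hB, p, hp, q, hq, fun z hz => h' ⟨z, h z.2⟩ hz⟩
    glue := by
      intro U f hf y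
      obtain ⟨A, hA, hy, h⟩ := hf y
      obtain ⟨B, hB, p, hp, q, hq, h'⟩ := h ⟨y, hy⟩
      exact ⟨A ⊓ B, ⟨hy, hB⟩, p, hp, q, hq, fun z hz => h' ⟨z, hz.1⟩ hz.2⟩ }

/-- The quotient of a space with functions by an equivalence relation: it carries the quotient
topology, and a function is regular if its pull-back is regular. -/
def quotientSpace (X : FunctionedSpace.{u, w} k) (s : Setoid X.carrier) :
    FunctionedSpace.{u, w} k where
  carrier := Quotient s
  regular U :=
    { carrier := {f | (fun y : TopologicalSpace.Opens.comap ⟨_, continuous_quotient_mk'⟩ U =>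
        f ⟨Quotient.mk s y, y.2⟩) ∈
          X.regular (TopologicalSpace.Opens.comap ⟨_, continuous_quotient_mk'⟩ U)}
      mul_mem' := fun hf hg => Subalgebra.mul_mem _ hf hg
      add_mem' := fun hf hg => Subalgebra.add_mem _ hf hg
      algebraMap_mem' := fun c => Subalgebra.algebraMap_mem _ c }
  restrict {U U'} h f hf :=
    X.restrict (U' := TopologicalSpace.Opens.comap ⟨_, continuous_quotient_mk'⟩ U')
      (fun _ hy => h hy) _ hf
  glue U f hf := by
    refine X.glue _ _ fun y => ?_
    obtain ⟨A, hA, hy, h⟩ := hf ⟨Quotient.mk s y, y.2⟩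
    exact ⟨TopologicalSpace.Opens.comap ⟨_, continuous_quotient_mk'⟩ A, fun _ hz => hA hz, hy, h⟩

end Spaces

/-! ## Homogeneous fiber bundles -/

section Bundles

variable {k : Type w} [Field k] {V : Type u} [Quiver.{v} V] [DecidableEq V] {d : V → ℕ}

/-- The orbit relation on `GL(d(x)) × S` of the action `p · (g, M) = (g p⁻¹, p · M)` of a subgroup
`P` of `GL(d(x))` under which `S` is stable. -/
def bundleSetoid (x : V) (P : Subgroup (GL (Fin (d x)) k)) (S : Set (RepSpace k d)) :
    Setoid (GL (Fin (d x)) k × S) where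
  r u u' := ∃ p ∈ P, u'.1 = u.1 * p⁻¹ ∧ (u'.2 : RepSpace k d) = vertexAct x p u.2
  iseqv :=
    { refl := fun u => ⟨1, P.one_mem, by simp, by simp [vertexAct_one]⟩
      symm := by
        rintro u u' ⟨p, hp, h1, h2⟩
        refine ⟨p⁻¹, P.inv_mem hp, by simp [h1], ?_⟩
        rw [h2, ← vertexAct_mul, inv_mul_cancel, vertexAct_one]
      trans := by
        rintro u u' u'' ⟨p, hp, h1, h2⟩ ⟨q, hq, h3, h4⟩
        refine ⟨q * p, P.mul_mem hq hp, by simp [h1, h3, mul_assoc], ?_⟩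
        rw [h4, h2, vertexAct_mul] }

/-- The product variety `GL(d(x)) × S`, as a subset of the vector space
`Mat(d(x), d(x)) × rep_Q(d)`. -/
def prodSpace (x : V) (S : Set (RepSpace k d)) : FunctionedSpace k :=
  subvariety (T := GL (Fin (d x)) k × S) (W := Matrix (Fin (d x)) (Fin (d x)) k × RepSpace k d)
    (k := k) fun u => (u.1.val, u.2.val)

/-- The homogeneous fiber bundle `GL(d(x)) ×_P S`: the quotient of `GL(d(x)) × S` by `P`. -/
def bundle (x : V) (P : Subgroup (GL (Fin (d x)) k)) (S : Set (RepSpace k d)) : FunctionedSpace k :=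
  quotientSpace (prodSpace x S) (bundleSetoid x P S)

/-- The point of `GL(d(x)) ×_P S` represented by `(g, M)`. -/
def bundleMk {x : V} (P : Subgroup (GL (Fin (d x)) k)) {S : Set (RepSpace k d)}
    (g : GL (Fin (d x)) k) (M : S) : (bundle x P S).carrier :=
  Quotient.mk (bundleSetoid x P S) (g, M)

end Bundles

end NodeSplitting

end

open NodeSplitting

/-! Write E_r for the span of the first r basis vectors of k^{d(x)} (`coordSubspace`) and h_x(N) for
`headMap N x`. Everything is governed by the image of h_x(N). Since x is a node, the arrows out of x
kill im h_x(N) for every N in rep_A(d). So if im h_x(N) = E_r, then N has block form. Conversely, a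
path of positive length in Q either lifts to Q^x or contains two consecutive arrows through x; paths
of the second kind lie in I and act by zero in block form. Hence the embedded rep_{A^x} is exactly
the set of block-form points of rep_A(d) (`mem_splitRepVariety_iff`). If some point has x-rank r, a
translate of it has im h_x = E_r, so the maximal rank is r and the fibre S of the bundle is {N | im
h_x(N) = E_r} (`mem_maxRankLocus_iff`). Now N ↦ im h_x(N) is an equivariant map from the rank
stratum to the Grassmannian GL/P_r, with fibre S over E_r, and P_r is the stabilizer of E_r
(`mem_parabolic_iff`). The inverse of Ψ sends N to the class of (g, g⁻¹N) for any g with g E_r = im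
h_x(N); the class does not depend on g (`bundleMk_eq_of_vertexAct_eq`). It is a morphism because g
can be chosen locally with polynomial entries (`exists_local_frame`). Local closedness comes from
the polynomial nature of the relations and the semicontinuity of rank (`isOpen_le_xRank`). -/

namespace NodeSplitting

/-! ### Algebras of functions, regular maps to vector spaces, polynomial functions -/

section RegularMaps

variable {k : Type w} [Field k] {T : Type*} (R : Subalgebra k (T → k))

/-- A map to a vector space is regular with respect to an algebra `R` of functions if its
composites with all linear functionals lie in `R`. -/
def IsRegularMap {W : Type*} [AddCommGroup W] [Module k W] (φ : T → W) : Prop :=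
  ∀ l : W →ₗ[k] k, (fun t => l (φ t)) ∈ R

variable {R}

theorem isRegularMap_of_mem {f : T → k} (hf : f ∈ R) : IsRegularMap R f := by
  intro l
  have h : (fun t => l (f t)) = l 1 • f := by
    funext t
    have h1 := l.map_smul (f t) 1
    simp only [smul_eq_mul, mul_one] at h1
    simp [h1, mul_comm]
  rw [h]
  exact R.smul_mem hf _

theorem IsRegularMap.mem {f : T → k} (hf : IsRegularMap R f) : f ∈ R := hf LinearMap.id

theorem IsRegularMap.comp_linear {W W' : Type*} [AddCommGroup W] [Module k W] [AddCommGroup W']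
    [Module k W'] {φ : T → W} (h : IsRegularMap R φ) (l : W →ₗ[k] W') :
    IsRegularMap R fun t => l (φ t) :=
  fun l' => h (l' ∘ₗ l)

theorem isRegularMap_pi {ι : Type*} [Finite ι] {W : ι → Type*} [∀ i, AddCommGroup (W i)]
    [∀ i, Module k (W i)] {φ : T → ∀ i, W i} (h : ∀ i, IsRegularMap R fun t => φ t i) :
    IsRegularMap R φ := by
  classical
  have := Fintype.ofFinite ι
  intro l
  have h1 : (fun t => l (φ t)) = ∑ i, fun t => (l ∘ₗ LinearMap.single k W i) (φ t i) := by
    funext t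
    simp only [Finset.sum_apply, LinearMap.comp_apply, LinearMap.single_apply]
    rw [← map_sum, Finset.univ_sum_single]
  rw [h1]
  exact sum_mem fun i _ => h i _

theorem isRegularMap_prod {W W' : Type*} [AddCommGroup W] [Module k W] [AddCommGroup W']
    [Module k W'] {φ : T → W} {φ' : T → W'} (h : IsRegularMap R φ) (h' : IsRegularMap R φ') :
    IsRegularMap R fun t => (φ t, φ' t) := by
  intro l
  have h1 : (fun t => l (φ t, φ' t)) = (fun t => (l ∘ₗ LinearMap.inl k W W') (φ t)) +
      fun t => (l ∘ₗ LinearMap.inr k W W') (φ' t) := by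
    funext t
    simp [← map_add]
  rw [h1]
  exact add_mem (h _) (h' _)

theorem isRegularMap_matrix {m n : Type*} [Finite m] [Finite n] {A : T → Matrix m n k}
    (h : ∀ i j, (fun t => A t i j) ∈ R) : IsRegularMap R A :=
  isRegularMap_pi (W := fun _ : m => n → k) fun i =>
    isRegularMap_pi (W := fun _ : n => k) fun j => isRegularMap_of_mem (h i j)

theorem IsRegularMap.entry {m n : Type*} {A : T → Matrix m n k} (h : IsRegularMap R A) (i : m)
    (j : n) : (fun t => A t i j) ∈ R :=
  h (LinearMap.proj (R := k) (φ := fun _ : n => k) j ∘ₗ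
    LinearMap.proj (R := k) (φ := fun _ : m => n → k) i)

theorem const_mem (c : k) : (fun _ : T => c) ∈ R := R.algebraMap_mem c

theorem mul_entry_mem {m n p : Type*} [Fintype n] {A : T → Matrix m n k} {B : T → Matrix n p k}
    (hA : ∀ i j, (fun t => A t i j) ∈ R) (hB : ∀ i j, (fun t => B t i j) ∈ R) (i : m) (j : p) :
    (fun t => (A t * B t) i j) ∈ R := by
  have h : (fun t => (A t * B t) i j) = ∑ l, (fun t => A t i l) * fun t => B t l j := by
    funext t
    simp [Matrix.mul_apply]
  rw [h]
  exact sum_mem fun l _ => mul_mem (hA i l) (hB l j)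

theorem det_mem {n : Type*} [Fintype n] [DecidableEq n] {A : T → Matrix n n k}
    (hA : ∀ i j, (fun t => A t i j) ∈ R) : (fun t => (A t).det) ∈ R := by
  have h : (fun t => (A t).det) = ∑ σ : Equiv.Perm n,
      (fun _ => ((Equiv.Perm.sign σ : ℤ) : k)) * ∏ i, fun t => A t (σ i) i := by
    funext t
    simp [Matrix.det_apply']
  rw [h]
  exact sum_mem fun σ _ => mul_mem (const_mem _) (prod_mem fun i _ => hA _ _)

/-- Cramer's rule: each entry of the adjugate is the determinant of `A` with one row replaced by a
constant one, so the determinant is all that has to be inverted in `R`. -/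
theorem inv_entry_mem {n : Type*} [Fintype n] [DecidableEq n] {A : T → Matrix n n k}
    (hA : ∀ i j, (fun t => A t i j) ∈ R) (hd : (fun t => (A t).det⁻¹) ∈ R) (i j : n) :
    (fun t => (A t)⁻¹ i j) ∈ R := by
  have h : (fun t => (A t)⁻¹ i j) = (fun t => (A t).det⁻¹) *
      fun t => ((A t).updateRow j (Pi.single i 1)).det := by
    funext t
    simp [Matrix.inv_def, Matrix.adjugate_apply]
  rw [h]
  refine mul_mem hd (det_mem fun a b => ?_)
  by_cases hj : a = j
  · subst hj
    simpa using const_mem _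
  · simpa [Matrix.updateRow_ne hj] using hA a b

/-- Linear functionals generate `polyFun`, so testing on them is enough. With `R` arbitrary, the
lemmas of this section serve both for polynomials (`polyFun`) and for regular functions on a
subvariety (`regularFun`). -/
theorem comp_polyFun_mem {W : Type*} [AddCommGroup W] [Module k W] {φ : T → W}
    (hφ : IsRegularMap R φ) {p : W → k} (hp : p ∈ polyFun k W) : (fun t => p (φ t)) ∈ R := by
  induction hp using Algebra.adjoin_induction with
  | mem p h => obtain ⟨l, rfl⟩ := h; exact hφ l
  | algebraMap c => exact const_mem c
  | add p q _ _ h h' => exact add_mem h h'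
  | mul p q _ _ h h' => exact mul_mem h h'

theorem isRegularMap_id {W : Type*} [AddCommGroup W] [Module k W] :
    IsRegularMap (polyFun k W) (id : W → W) :=
  fun l => Algebra.subset_adjoin ⟨l, rfl⟩

theorem isOpen_zariski_ne_zero {W : Type*} [AddCommGroup W] [Module k W] {p : W → k}
    (hp : p ∈ polyFun k W) : @IsOpen W (zariski k W) {y | p y ≠ 0} :=
  TopologicalSpace.isOpen_generateFrom_of_mem ⟨p, hp, rfl⟩

theorem isClosed_zariski_eq_zero {W : Type*} [AddCommGroup W] [Module k W] {p : W → k}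
    (hp : p ∈ polyFun k W) : @IsClosed W (zariski k W) {y | p y = 0} := by
  let _ := zariski k W
  exact ⟨by simpa [Set.compl_def] using isOpen_zariski_ne_zero hp⟩

end RegularMaps

/-! ### Regular functions and morphisms on quasi-affine varieties -/

section Subvarieties

variable {k : Type w} [Field k] {T : Type*} {W : Type*} [AddCommGroup W] [Module k W]

/-- The algebra of globally regular functions on a subvariety. -/
def regularFun (ι : T → W) : Subalgebra k (T → k) :=
  let R := (subvariety (k := k) ι).regular ⊤
  { carrier := {f |
      (fun y : (⊤ : TopologicalSpace.Opens (subvariety (k := k) ι).carrier) => f y.1) ∈ R}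
    mul_mem' := fun hf hg => R.mul_mem hf hg
    add_mem' := fun hf hg => R.add_mem hf hg
    algebraMap_mem' := fun c => R.algebraMap_mem c }

theorem mem_regularFun {ι : T → W} {f : T → k} : f ∈ regularFun ι ↔
    ∀ y, ∃ U : Set T, @IsOpen T ((zariski k W).induced ι) U ∧ y ∈ U ∧
      ∃ p ∈ polyFun k W, ∃ q ∈ polyFun k W, ∀ z ∈ U, q (ι z) ≠ 0 ∧ f z = p (ι z) / q (ι z) := by
  constructor
  · intro h y
    have h : (fun y : (⊤ : TopologicalSpace.Opens (subvariety (k := k) ι).carrier) => f y.1) ∈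
      (subvariety (k := k) ι).regular ⊤ := h
    obtain ⟨⟨U, hU⟩, hy, p, hp, q, hq, h⟩ := h ⟨y, trivial⟩
    exact ⟨U, hU, hy, p, hp, q, hq, fun z hz => h ⟨z, trivial⟩ hz⟩
  · intro h
    change (fun y : (⊤ : TopologicalSpace.Opens (subvariety (k := k) ι).carrier) => f y.1) ∈
      (subvariety (k := k) ι).regular ⊤
    intro y
    obtain ⟨U, hU, hy, p, hp, q, hq, h⟩ := h y.1
    exact ⟨TopologicalSpace.Opens.mk (α := (subvariety (k := k) ι).carrier) U hU, hy, p, hp, q, hq,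
      fun z hz => h z.1 hz⟩

theorem polyFun_comp_mem_regularFun {ι : T → W} {p : W → k} (hp : p ∈ polyFun k W) :
    (fun t => p (ι t)) ∈ regularFun ι := by
  let _ := (zariski k W).induced ι
  exact mem_regularFun.2 fun y => ⟨Set.univ, isOpen_univ, trivial, p, hp, 1, one_mem _,
    fun z _ => by simp⟩

theorem isRegularMap_subvariety (ι : T → W) : IsRegularMap (regularFun (k := k) ι) ι :=
  fun l => polyFun_comp_mem_regularFun (isRegularMap_id l)

theorem isOpen_induced_ne_zero (ι : T → W) {p : W → k} (hp : p ∈ polyFun k W) :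
    @IsOpen T ((zariski k W).induced ι) {t | p (ι t) ≠ 0} := by
  let _ := zariski k W
  exact isOpen_induced (isOpen_zariski_ne_zero hp)

/-- Where f = p / q, the function f vanishes exactly where p does. Continuity of regular maps rests
on this. -/
theorem isOpen_ne_zero {ι : T → W} {f : T → k} (hf : f ∈ regularFun ι) :
    @IsOpen T ((zariski k W).induced ι) {t | f t ≠ 0} := by
  let _ := (zariski k W).induced ι
  refine isOpen_iff_forall_mem_open.2 fun y hy => ?_
  obtain ⟨U, hU, hyU, p, hp, q, hq, h⟩ := mem_regularFun.1 hf y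
  refine ⟨U ∩ {t | p (ι t) ≠ 0}, ?_, hU.inter (isOpen_induced_ne_zero ι hp), hyU, ?_⟩
  · rintro z ⟨hz, hpz⟩
    obtain ⟨h1, h2⟩ := h z hz
    rw [Set.mem_ofPred_eq, h2]
    exact div_ne_zero hpz h1
  · rintro h0
    apply hy
    rw [(h y hyU).2, h0, zero_div]

theorem inv_mem_regularFun {ι : T → W} {f : T → k} (hf : f ∈ regularFun ι) (h0 : ∀ t, f t ≠ 0) :
    (fun t => (f t)⁻¹) ∈ regularFun ι := by
  refine mem_regularFun.2 fun y => ?_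
  obtain ⟨U, hU, hyU, p, hp, q, hq, h⟩ := mem_regularFun.1 hf y
  refine ⟨U, hU, hyU, q, hq, p, hp, fun z hz => ?_⟩
  obtain ⟨h1, h2⟩ := h z hz
  refine ⟨fun h3 => h0 z ?_, ?_⟩
  · rw [h2, h3, zero_div]
  · rw [h2, inv_div]

variable {T' : Type*} {W' : Type*} [AddCommGroup W'] [Module k W']

/-- Being a morphism reduces to the linear coordinates: numerator and denominator of a local
quotient p / q pull back to regular functions p₁/q₁ and p₂/q₂, and the quotient pulls back to p₁q₂ /
(q₁p₂). -/
theorem isMorphism_of_isRegularMap {ι : T → W} {ι' : T' → W'} {φ : T → T'}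
    (h : IsRegularMap (regularFun (k := k) ι) fun t => ι' (φ t)) :
    IsMorphism (subvariety (k := k) ι) (subvariety (k := k) ι') φ := by
  let t1 : TopologicalSpace T := (zariski k W).induced ι
  let t2 : TopologicalSpace T' := (zariski k W').induced ι'
  have hc : Continuous φ := by
    refine continuous_induced_rng.2 (continuous_generateFrom_iff.2 ?_)
    rintro _ ⟨p, hp, rfl⟩
    exact isOpen_ne_zero (comp_polyFun_mem h hp)
  refine ⟨hc, fun U f hf y => ?_⟩
  obtain ⟨A, hA, p, hp, q, hq, hpq⟩ := hf ⟨φ y.1, y.2⟩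
  obtain ⟨B, hB, hyB, p1, hp1, q1, hq1, h1⟩ := mem_regularFun.1 (comp_polyFun_mem h hp) y.1
  obtain ⟨C, hC, hyC, p2, hp2, q2, hq2, h2⟩ := mem_regularFun.1 (comp_polyFun_mem h hq) y.1
  refine ⟨⟨φ ⁻¹' A ∩ (B ∩ C), (A.2.preimage hc).inter (hB.inter hC)⟩, ⟨hA, hyB, hyC⟩,
    p1 * q2, mul_mem hp1 hq2, q1 * p2, mul_mem hq1 hp2, ?_⟩
  rintro z ⟨hzA, hzB, hzC⟩
  obtain ⟨h3, h4⟩ := hpq ⟨φ z.1, z.2⟩ hzA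
  obtain ⟨h5, h6⟩ := h1 z.1 hzB
  obtain ⟨h7, h8⟩ := h2 z.1 hzC
  have h9 : p2 (ι z.1) ≠ 0 := by
    intro h9
    apply h3
    change q (ι' (φ z.1)) = 0
    rw [h8, h9, zero_div]
  refine ⟨mul_ne_zero h5 h9, ?_⟩
  refine h4.trans ?_
  change p (ι' (φ z.1)) / q (ι' (φ z.1)) = p1 (ι z.1) * q2 (ι z.1) / (q1 (ι z.1) * p2 (ι z.1))
  rw [h6, h8]
  field_simp

/-- Continuity and regularity are local on the source. The target is any space with functions, so
that it may be a quotient. -/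
theorem isMorphism_of_locally {ι : T → W} {Z : FunctionedSpace k} {ψ : T → Z.carrier}
    (h : ∀ y, ∃ U : Set T, @IsOpen T ((zariski k W).induced ι) U ∧ y ∈ U ∧
      IsMorphism (subvariety (k := k) fun t : U => ι t) Z fun t : U => ψ t) :
    IsMorphism (subvariety (k := k) ι) Z ψ := by
  let t1 : TopologicalSpace T := (zariski k W).induced ι
  have ht (U : Set T) : (zariski k W).induced (fun t : U => ι t) =
      (instTopologicalSpaceSubtype : TopologicalSpace U) := by
    change _ = TopologicalSpace.induced _ (TopologicalSpace.induced _ _)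
    rw [induced_compose]
    rfl
  have hc : Continuous ψ := by
    refine continuous_iff_continuousAt.2 fun y => ?_
    obtain ⟨U, hU, hyU, hm, -⟩ := h y
    have h1 : Continuous fun t : U => ψ t := by
      rw [← ht U]
      exact hm
    exact (continuousOn_iff_continuous_domRestrict.2 h1).continuousAt (hU.mem_nhds hyU)
  refine ⟨hc, fun A f hf y => ?_⟩
  obtain ⟨U, hU, hyU, hm, hreg⟩ := h y.1
  obtain ⟨B, hB, p, hp, q, hq, hpq⟩ := hreg A f hf ⟨⟨y.1, hyU⟩, y.2⟩
  obtain ⟨B, hBo⟩ := B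
  change @IsOpen U ((zariski k W).induced _) B at hBo
  rw [ht U] at hBo
  -- As U is open, an open subset of U is open in T, and the same p and q work there.
  refine ⟨⟨_, hU.isOpenMap_subtype_val _ hBo⟩, ⟨⟨y.1, hyU⟩, hB, rfl⟩, p, hp, q, hq, ?_⟩
  rintro ⟨z, hz⟩ ⟨z', hz', h2⟩
  change z'.1 = z at h2
  subst h2
  exact hpq ⟨z', hz⟩ hz'

end Subvarieties

/-! ### Morphisms into and out of quotients -/

section Spaces

variable {k : Type w} [Field k]

theorem IsMorphism.comp {X Y Z : FunctionedSpace k} {φ : X.carrier → Y.carrier}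
    {ψ : Y.carrier → Z.carrier} (hψ : IsMorphism Y Z ψ) (hφ : IsMorphism X Y φ) :
    IsMorphism X Z fun t => ψ (φ t) := by
  obtain ⟨h1, h2⟩ := hφ
  obtain ⟨h3, h4⟩ := hψ
  exact ⟨h3.comp h1, fun U f hf => h2 _ _ (h4 U f hf)⟩

theorem isMorphism_quotientMk (X : FunctionedSpace.{u, w} k) (s : Setoid X.carrier) :
    IsMorphism X (quotientSpace X s) (Quotient.mk s) :=
  ⟨continuous_quotient_mk', fun _ _ hf => hf⟩

theorem isMorphism_of_quotient {X : FunctionedSpace.{u, w} k} {s : Setoid X.carrier}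
    {Z : FunctionedSpace k} {φ : Quotient s → Z.carrier}
    (h : IsMorphism X Z fun t => φ (Quotient.mk s t)) : IsMorphism (quotientSpace X s) Z φ := by
  obtain ⟨h1, h2⟩ := h
  exact ⟨isQuotientMap_quotient_mk'.continuous_iff.2 h1, fun U f hf => h2 U f hf⟩

end Spaces

/-! ### Base change and the action of the path algebra -/

section Evaluation

variable {k : Type w} [Field k] {V : Type u} [Quiver.{v} V] {d : V → ℕ}

theorem pathMatrix_baseChange (g : ∀ z, GL (Fin (d z)) k) (M : RepSpace k d) {a b : V}
    (p : Quiver.Path a b) :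
    pathMatrix (baseChange g M) p = (g b).val * pathMatrix M p * (g a)⁻¹.val := by
  induction p with
  | nil => simp [pathMatrix]
  | @cons b c p f ih =>
    have h : (g b)⁻¹.val * (g b).val = 1 := (g b).inv_mul
    calc pathMatrix (baseChange g M) (p.cons f)
        = (g c).val * M b c f * ((g b)⁻¹.val * (g b).val) * pathMatrix M p * (g a)⁻¹.val := by
          simp only [pathMatrix, ih, baseChange, Matrix.mul_assoc]
      _ = _ := by
          rw [h]
          simp only [pathMatrix, Matrix.mul_assoc, Matrix.mul_one]

variable [DecidableEq V]

theorem evalRep_ofPath (M : RepSpace k d) {a b : V} (p : Quiver.Path a b) :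
    evalRep M (ofPath k ⟨a, b, p⟩) = LinearMap.single k (fun z => Fin (d z) → k) b ∘ₗ
      (pathMatrix M p).mulVecLin ∘ₗ LinearMap.proj a := by
  simp [evalRep]

theorem evalRep_ofPath_eq_zero_iff (M : RepSpace k d) {a b : V} (p : Quiver.Path a b) :
    evalRep M (ofPath k ⟨a, b, p⟩) = 0 ↔ pathMatrix M p = 0 := by
  rw [evalRep_ofPath]
  constructor
  · intro h
    apply Matrix.mulVec_injective
    funext v
    have h1 := congrFun (LinearMap.congr_fun h (Pi.single a v)) b
    simpa using h1
  · intro h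
    ext
    simp [h]

/-- The action of the base change group on the total space of a representation. -/
def totalMap (g : ∀ z, GL (Fin (d z)) k) : (∀ z, Fin (d z) → k) →ₗ[k] (∀ z, Fin (d z) → k) :=
  LinearMap.pi fun z => (g z).val.mulVecLin ∘ₗ LinearMap.proj z

/-- Base change conjugates the action of the path algebra, because inner factors cancel along a
path; the relations in I are therefore preserved. -/
theorem evalRep_baseChange (g : ∀ z, GL (Fin (d z)) k) (M : RepSpace k d) (a : PathAlgebra k V) :
    evalRep (baseChange g M) a = totalMap g ∘ₗ evalRep M a ∘ₗ totalMap g⁻¹ := by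
  induction a using elemInduction with
  | zero => simp
  | add a b ha hb => simp only [map_add, ha, hb, LinearMap.comp_add, LinearMap.add_comp]
  | smul t p =>
    obtain ⟨a, b, p⟩ := p
    simp only [map_smul, LinearMap.comp_smul, LinearMap.smul_comp]
    congr 1
    refine LinearMap.ext fun v => funext fun z => ?_
    rw [evalRep_ofPath, evalRep_ofPath, pathMatrix_baseChange]
    by_cases hz : z = b
    · subst hz
      simp [totalMap, Matrix.mulVec_mulVec, Matrix.mul_assoc]
    · simp [totalMap, hz]

theorem baseChange_mem_repVariety [Fintype V] {I : TwoSidedIdeal (PathAlgebra k V)}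
    (g : ∀ z, GL (Fin (d z)) k) {M : RepSpace k d} (hM : M ∈ repVariety I d) :
    baseChange g M ∈ repVariety I d := by
  intro a ha
  rw [evalRep_baseChange, hM a ha]
  simp

theorem vertexAct_mem_repVariety [Fintype V] {I : TwoSidedIdeal (PathAlgebra k V)} {x : V}
    (g : GL (Fin (d x)) k) {M : RepSpace k d} (hM : M ∈ repVariety I d) :
    vertexAct x g M ∈ repVariety I d :=
  baseChange_mem_repVariety _ hM

theorem vertexAct_inv_apply {x : V} (g : GL (Fin (d x)) k) (M : RepSpace k d) :
    vertexAct x g⁻¹ (vertexAct x g M) = M := by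
  rw [← vertexAct_mul, inv_mul_cancel, vertexAct_one]

theorem vertexAct_apply_inv {x : V} (g : GL (Fin (d x)) k) (M : RepSpace k d) :
    vertexAct x g (vertexAct x g⁻¹ M) = M := by
  rw [← vertexAct_mul, mul_inv_cancel, vertexAct_one]

/-- The right factor stays a `Pi.mulSingle`: this treats loops at x together with the other arrows,
and its value is irrelevant for bounding the image. -/
theorem vertexAct_head {x a : V} (g : GL (Fin (d x)) k) (M : RepSpace k d) (f : a ⟶ x) :
    vertexAct x g M a x f =
      g.val * M a x f * ((Pi.mulSingle x g : ∀ z, GL (Fin (d z)) k) a)⁻¹.val := by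
  simp [vertexAct, baseChange]

/-- The arrows out of a node annihilate the arrows into it. -/
theorem mul_eq_zero_of_isNode [Fintype V] {I : TwoSidedIdeal (PathAlgebra k V)} {x : V}
    (hx : IsNode I x) {M : RepSpace k d} (hM : M ∈ repVariety I d) {y z : V} (f : y ⟶ x)
    (g : x ⟶ z) : M x z g * M y x f = 0 := by
  have h := (evalRep_ofPath_eq_zero_iff M _).1 (hM _ (hx y z f g))
  simpa [pathMatrix, Quiver.Hom.toPath] using h

end Evaluation

/-! ### Equivariance of the image of the arrows into x -/

section Rank

variable {k : Type w} [Field k] {V : Type u} [Quiver.{v} V] {d : V → ℕ} [Fintype V]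
  [∀ a b : V, Fintype (a ⟶ b)]

theorem headMap_apply (M : RepSpace k d) (x : V)
    (v : ∀ α : Σ a : V, (a ⟶ x), Fin (d α.1) → k) :
    headMap M x v = ∑ α : Σ a : V, (a ⟶ x), (M α.1 x α.2).mulVec (v α) := by
  simp [headMap]

theorem range_headMap_le_iff {M : RepSpace k d} {x : V} {K : Submodule k (Fin (d x) → k)} :
    LinearMap.range (headMap M x) ≤ K ↔ ∀ (a : V) (f : a ⟶ x) v, (M a x f).mulVec v ∈ K := by
  constructor
  · intro h a f v
    classical
    refine h ⟨Pi.single ⟨a, f⟩ v, ?_⟩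
    rw [headMap_apply, Finset.sum_eq_single ⟨a, f⟩]
    · simp
    · intro b _ hb
      simp [hb]
    · simp
  · rintro h _ ⟨v, rfl⟩
    rw [headMap_apply]
    exact K.sum_mem fun α _ => h _ _ _

theorem mulVec_mem_range_headMap (M : RepSpace k d) {x a : V} (f : a ⟶ x) (v : Fin (d a) → k) :
    (M a x f).mulVec v ∈ LinearMap.range (headMap M x) :=
  range_headMap_le_iff.1 le_rfl a f v

variable [DecidableEq V]

theorem range_headMap_vertexAct (x : V) (g : GL (Fin (d x)) k) (M : RepSpace k d) :
    LinearMap.range (headMap (vertexAct x g M) x) =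
      (LinearMap.range (headMap M x)).map g.val.mulVecLin := by
  have h (g : GL (Fin (d x)) k) (M : RepSpace k d) :
      LinearMap.range (headMap (vertexAct x g M) x) ≤
        (LinearMap.range (headMap M x)).map g.val.mulVecLin := by
    refine range_headMap_le_iff.2 fun a f v => ?_
    rw [vertexAct_head, Matrix.mul_assoc, ← Matrix.mulVec_mulVec, ← Matrix.mulVec_mulVec]
    exact ⟨_, mulVec_mem_range_headMap M f _, rfl⟩
  refine le_antisymm (h g M) ?_
  -- The reverse inclusion is the one already shown, applied to g⁻¹ and g · M.
  have h1 := h g⁻¹ (vertexAct x g M)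
  rw [vertexAct_inv_apply] at h1
  rintro _ ⟨v, hv, rfl⟩
  obtain ⟨v, hv', rfl⟩ := h1 hv
  simpa [Matrix.mulVec_mulVec, ← Matrix.coe_units_inv] using hv'

theorem xRank_vertexAct (x : V) (g : GL (Fin (d x)) k) (M : RepSpace k d) :
    xRank x (vertexAct x g M) = xRank x M := by
  rw [xRank, xRank, range_headMap_vertexAct]
  exact (Submodule.equivMapOfInjective g.val.mulVecLin
    (Matrix.mulVec_injective_iff_isUnit.2 g.isUnit) _).finrank_eq.symm

end Rank

/-! ### The coordinate subspace, its stabilizer, and block form -/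

section Blocks

variable {k : Type w} [Field k] {V : Type u} [Quiver.{v} V] {d : V → ℕ}

variable (k) in
/-- The span of the first `r` standard basis vectors of `k ^ n`. -/
def coordSubspace (n r : ℕ) : Submodule k (Fin n → k) :=
  ⨅ i ∈ {i : Fin n | r ≤ i.val}, LinearMap.ker (LinearMap.proj i : (Fin n → k) →ₗ[k] k)

theorem mem_coordSubspace {n r : ℕ} {v : Fin n → k} :
    v ∈ coordSubspace k n r ↔ ∀ i : Fin n, r ≤ i.val → v i = 0 := by
  simp [coordSubspace]

theorem finrank_coordSubspace {n r : ℕ} (hr : r ≤ n) :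
    Module.finrank k (coordSubspace k n r) = r := by
  have e := LinearMap.iInfKerProjEquiv k (fun _ : Fin n => k)
    (I := {i : Fin n | i.val < r}) (J := {i : Fin n | r ≤ i.val})
    (Set.disjoint_left.2 fun i hi hj => by simp at hi hj; omega)
    (fun i _ => by simp; omega)
  rw [coordSubspace, e.finrank_eq, Module.finrank_fintype_fun_eq_card]
  have e' : {i : Fin n | i.val < r} ≃ Fin r :=
    { toFun := fun i => ⟨i.1.val, i.2⟩
      invFun := fun i => ⟨⟨i.val, i.2.trans_le hr⟩, i.2⟩
      left_inv := fun _ => rfl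
      right_inv := fun _ => rfl }
  rw [Fintype.card_congr e', Fintype.card_fin]

/-- P_r is the stabilizer of E_r: the lower left block of g holds the components outside E_r of the
images of the first r basis vectors. -/
theorem mem_parabolic_iff {n r : ℕ} {g : GL (Fin n) k} : g ∈ parabolic k n r ↔
    ∀ v ∈ coordSubspace k n r, g.val.mulVec v ∈ coordSubspace k n r := by
  have h : g ∈ parabolic k n r ↔ ∀ i j : Fin n, r ≤ i.val → j.val < r → g.val i j = 0 := by
    change (∀ i j : Fin n, decide (r ≤ j.val) < decide (r ≤ i.val) → g.val i j = 0) ↔ _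
    -- In `Bool` only `false < true` holds, so the condition concerns rows i ≥ r and columns j < r.
    simp only [Bool.lt_iff, decide_eq_false_iff_not, decide_eq_true_eq, not_le]
    exact forall₂_congr fun i j => by tauto
  rw [h]
  simp only [mem_coordSubspace]
  constructor
  · intro h v hv i hi
    rw [Matrix.mulVec, dotProduct]
    refine Finset.sum_eq_zero fun j _ => ?_
    rcases lt_or_ge j.val r with hj | hj
    · rw [h i j hi hj, zero_mul]
    · rw [hv j hj, mul_zero]
  · intro h i j hi hj
    have h1 := h (Pi.single j 1) (fun l hl => by
      rw [Pi.single_eq_of_ne]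
      rintro rfl
      omega) i hi
    simpa using h1

/-- Representations in block form: the images of the arrows into `x` lie in the span of the first
`r` standard basis vectors, and the arrows out of `x` vanish on it. -/
def IsBlockForm (x : V) (r : ℕ) (N : RepSpace k d) : Prop :=
  (∀ (a : V) (f : a ⟶ x) v, (N a x f).mulVec v ∈ coordSubspace k (d x) r) ∧
    ∀ (b : V) (f : x ⟶ b), ∀ v ∈ coordSubspace k (d x) r, (N x b f).mulVec v = 0

theorem IsBlockForm.entry_eq_zero {x : V} {r : ℕ} {N : RepSpace k d}
    (hN : IsBlockForm x r N) {b : V} (f : x ⟶ b)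
    (i : Fin (d b)) (j : Fin (d x)) (hj : j.val < r) : N x b f i j = 0 := by
  have h := congrFun (hN.2 _ f (Pi.single j 1) (mem_coordSubspace.2 fun l hl => by
    rw [Pi.single_eq_of_ne]
    rintro rfl
    omega)) i
  simpa using h

/-- Block form refers only to E_r: p preserves it for the arrows into x, and p⁻¹ for the arrows out
of x. -/
theorem IsBlockForm.vertexAct [DecidableEq V] {x : V} {r : ℕ} {N : RepSpace k d}
    (hN : IsBlockForm x r N) {p : GL (Fin (d x)) k} (hp : p ∈ parabolic k (d x) r) :
    IsBlockForm x r (vertexAct x p N) := by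
  constructor
  · intro a f v
    rw [NodeSplitting.vertexAct, baseChange, Matrix.mul_assoc, ← Matrix.mulVec_mulVec,
      ← Matrix.mulVec_mulVec, Pi.mulSingle_eq_same]
    exact mem_parabolic_iff.1 hp _ (hN.1 a f _)
  · intro b f v hv
    rw [NodeSplitting.vertexAct, baseChange, Matrix.mul_assoc, ← Matrix.mulVec_mulVec,
      ← Matrix.mulVec_mulVec, Pi.mulSingle_eq_same,
      hN.2 b f _ (mem_parabolic_iff.1 (Subgroup.inv_mem _ hp) _ hv), Matrix.mulVec_zero]

end Blocks

open SplitVertex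

/-! ### Block inclusions -/

section Blocks

variable {k : Type w} [Field k] {V : Type u} {d : V → ℕ} {x : V} {r : ℕ}

theorem blockStart_add_splitDim_le (hr : r ≤ d x) (z : SplitVertex x) :
    blockStart r z + splitDim d x r z ≤ d z.proj := by
  cases z <;> simp [blockStart, splitDim, proj, hr]

theorem transpose_blockIncl_mul (hr : r ≤ d x) (z : SplitVertex x) :
    (blockIncl k d r z.proj z).transpose * blockIncl k d r z.proj z = 1 := by
  ext i j
  have h := blockStart_add_splitDim_le hr z
  have hi := i.2
  rw [Matrix.mul_apply, Finset.sum_eq_single ⟨blockStart r z + i.val, by omega⟩]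
  · simp [blockIncl, Matrix.one_apply, Fin.ext_iff]
  · intro l _ hl
    simp only [ne_eq, Fin.ext_iff] at hl
    simp [blockIncl, hl]
  · simp

theorem transpose_blockIncl_tail_mul_head :
    (blockIncl k d r x (tail : SplitVertex x)).transpose *
      blockIncl k d r x (head : SplitVertex x) = 0 := by
  ext i j
  have hj : j.val < r := j.2
  rw [Matrix.mul_apply]
  refine Finset.sum_eq_zero fun l _ => ?_
  rw [blockIncl, blockIncl, Matrix.transpose_apply, Matrix.of_apply, Matrix.of_apply]
  rcases lt_or_ge l.val r with h | h
  · rw [if_neg (by simp only [blockStart]; omega), zero_mul]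
  · rw [if_neg (c := l.val = blockStart r (head : SplitVertex x) + j.val)
      (by simp only [blockStart]; omega), mul_zero]

theorem transpose_blockIncl_head_mul_tail :
    (blockIncl k d r x (head : SplitVertex x)).transpose *
      blockIncl k d r x (tail : SplitVertex x) = 0 := by
  have h := congrArg Matrix.transpose (transpose_blockIncl_tail_mul_head (k := k) (d := d) (x := x)
    (r := r))
  simpa [Matrix.transpose_mul] using h

/-- The product is the coordinate projection onto the block of z, so it fixes vectors supported
there. -/
theorem blockIncl_mul_transpose_mulVec (hr : r ≤ d x) (z : SplitVertex x)
    {v : Fin (d z.proj) → k}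
    (hv : ∀ i, i.val < blockStart r z ∨ blockStart r z + splitDim d x r z ≤ i.val → v i = 0) :
    (blockIncl k d r z.proj z * (blockIncl k d r z.proj z).transpose).mulVec v = v := by
  ext i
  rw [← Matrix.mulVec_mulVec]
  have h := blockStart_add_splitDim_le hr z
  by_cases hi : i.val < blockStart r z ∨ blockStart r z + splitDim d x r z ≤ i.val
  · rw [hv i hi, Matrix.mulVec, dotProduct]
    refine Finset.sum_eq_zero fun j _ => ?_
    have hj := j.2
    rw [blockIncl, Matrix.of_apply, if_neg (by omega), zero_mul]
  · have h1 : (blockIncl k d r z.proj z).transpose.mulVec v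
        ⟨i.val - blockStart r z, by omega⟩ = v i := by
      rw [Matrix.mulVec, dotProduct, Finset.sum_eq_single i]
      · simp only [blockIncl, Matrix.transpose_apply, Matrix.of_apply]
        rw [if_pos (by omega), one_mul]
      · intro l _ hl
        simp only [blockIncl, Matrix.transpose_apply, Matrix.of_apply]
        rw [if_neg, zero_mul]
        intro h2
        exact hl (Fin.ext (by omega))
      · simp
    rw [Matrix.mulVec, dotProduct, Finset.sum_eq_single ⟨i.val - blockStart r z, by omega⟩, h1]
    · rw [blockIncl, Matrix.of_apply, if_pos (by simp; omega), one_mul]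
    · intro l _ hl
      rw [blockIncl, Matrix.of_apply, if_neg, zero_mul]
      intro h2
      exact hl (Fin.ext (by simp; omega))
    · simp

end Blocks

section Vertices

variable {V : Type u} [DecidableEq V] {x : V}

/-- Replacing a vertex of Q by the projection of a split vertex makes matrix sizes match without
casts. -/
theorem exists_proj_eq_ne_tail (a : V) : ∃ a' : SplitVertex x, a'.proj = a ∧ a' ≠ tail :=
  ⟨_, proj_asHead a, asHead_ne_tail a⟩

theorem exists_proj_eq_ne_head (a : V) : ∃ a' : SplitVertex x, a'.proj = a ∧ a' ≠ head :=
  ⟨_, proj_asTail a, asTail_ne_head a⟩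

end Vertices

/-! ### The block embedding on arrows and paths -/

section Embedding

variable {k : Type w} [Field k] {V : Type u} [Quiver.{v} V] [DecidableEq V] {d : V → ℕ} {x : V}
  {r : ℕ}

/-- No arrow of Q^x starts at x_h or ends at x_t, so its endpoints are determined by their images in
Q and agree with `asTail` and `asHead`. -/
theorem splitEmbedding_arrow (M : RepSpace k (splitDim d x r)) {a b : SplitVertex x} (f : a ⟶ b) :
    splitEmbedding d x r M a.proj b.proj f.1 =
      blockIncl k d r b.proj b * M a b f * (blockIncl k d r a.proj a).transpose := by
  obtain ⟨f, hfa, hfb⟩ := f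
  -- Variable endpoints allow the equalities to be substituted in the dependent matrix types.
  have h (a' b' : SplitVertex x) (ha : a'.proj = a.proj) (hb : b'.proj = b.proj) (ha' : a' ≠ head)
      (hb' : b' ≠ tail) : blockIncl k d r b.proj b' *
        M a' b' ⟨f.cast ha.symm hb.symm, ha', hb'⟩ * (blockIncl k d r a.proj a').transpose =
      blockIncl k d r b.proj b * M a b ⟨f, hfa, hfb⟩ * (blockIncl k d r a.proj a).transpose := by
    obtain rfl := proj_inj_of_ne_head ha' hfa ha
    obtain rfl := proj_inj_of_ne_tail hb' hfb hb
    rfl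
  exact h _ _ (proj_asTail _) (proj_asHead _) (asTail_ne_head _) (asHead_ne_tail _)

theorem isBlockForm_splitEmbedding (M : RepSpace k (splitDim d x r)) :
    IsBlockForm x r (splitEmbedding d x r M) := by
  constructor
  · intro a f v
    have h (z : SplitVertex x) (hz : z = head) (v : Fin (splitDim d x r z) → k) :
        (blockIncl k d r x z).mulVec v ∈ coordSubspace k (d x) r := by
      subst hz
      refine mem_coordSubspace.2 fun i hi => ?_
      rw [Matrix.mulVec, dotProduct]
      refine Finset.sum_eq_zero fun j _ => ?_
      have hj : j.val < r := j.2
      rw [blockIncl, Matrix.of_apply, if_neg (by simp [blockStart]; omega), zero_mul]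
    rw [splitEmbedding, Matrix.mul_assoc, ← Matrix.mulVec_mulVec]
    exact h _ (by simp [asHead]) _
  · intro b f v hv
    have h (z : SplitVertex x) (hz : z = tail) : (blockIncl k d r x z).transpose.mulVec v = 0 := by
      subst hz
      funext i
      rw [Matrix.mulVec, dotProduct]
      refine Finset.sum_eq_zero fun j _ => ?_
      rcases lt_or_ge j.val r with hj | hj
      · rw [blockIncl, Matrix.transpose_apply, Matrix.of_apply,
          if_neg (by simp [blockStart]; omega), zero_mul]
      · rw [mem_coordSubspace.1 hv j hj, mul_zero]
    rw [splitEmbedding, ← Matrix.mulVec_mulVec, h _ (by simp [asTail]), Matrix.mulVec_zero]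

/-- The preimage is cut out by restricting each matrix to the relevant block; block form says that
all discarded entries vanish. -/
theorem exists_splitEmbedding_eq (hr : r ≤ d x) {N : RepSpace k d} (hN : IsBlockForm x r N) :
    ∃ M, splitEmbedding d x r M = N := by
  refine ⟨fun a b f => (blockIncl k d r b.proj b).transpose * N a.proj b.proj f.1 *
    blockIncl k d r a.proj a, ?_⟩
  funext a b f
  obtain ⟨a, rfl, ha⟩ := exists_proj_eq_ne_head (x := x) a
  obtain ⟨b, rfl, hb⟩ := exists_proj_eq_ne_tail (x := x) b
  refine (splitEmbedding_arrow _ (⟨f, ha, hb⟩ : a ⟶ b)).trans ?_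
  have h1 (A : Matrix (Fin (d b.proj)) (Fin (d a.proj)) k)
      (hA : ∀ v i, i.val < blockStart r b ∨ blockStart r b + splitDim d x r b ≤ i.val →
        A.mulVec v i = 0) :
      blockIncl k d r b.proj b * (blockIncl k d r b.proj b).transpose * A = A := by
    apply Matrix.mulVec_injective
    funext v
    rw [← Matrix.mulVec_mulVec]
    exact blockIncl_mul_transpose_mulVec hr b (hA v)
  have h2 (A : Matrix (Fin (d b.proj)) (Fin (d a.proj)) k)
      (hA : ∀ i j, j.val < blockStart r a ∨ blockStart r a + splitDim d x r a ≤ j.val →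
        A i j = 0) :
      A * (blockIncl k d r a.proj a * (blockIncl k d r a.proj a).transpose) = A := by
    apply Matrix.transpose_injective
    rw [Matrix.transpose_mul, Matrix.transpose_mul, Matrix.transpose_transpose]
    ext j i
    exact congrFun (blockIncl_mul_transpose_mulVec (v := fun j => A i j) hr a (hA i)) j
  have h3 := h1 (N a.proj b.proj f) (fun v i hi => by
    have hi' := i.2
    cases b with
    | old z hz => simp [blockStart, splitDim, proj] at hi hi'; omega
    | tail => exact absurd rfl hb
    | head =>
      simp [blockStart, splitDim] at hi
      exact mem_coordSubspace.1 (hN.1 _ f v) i hi)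
  have h4 := h2 (N a.proj b.proj f) (fun i j hj => by
    have hj' := j.2
    cases a with
    | old z hz => simp [blockStart, splitDim, proj] at hj hj'; omega
    | tail =>
      simp only [blockStart, splitDim, proj] at hj hj'
      exact hN.entry_eq_zero f i j (by omega)
    | head => exact absurd rfl ha)
  calc _ = (blockIncl k d r b.proj b * (blockIncl k d r b.proj b).transpose * N a.proj b.proj f) *
        (blockIncl k d r a.proj a * (blockIncl k d r a.proj a).transpose) := by
        simp only [Matrix.mul_assoc]
    _ = _ := by rw [h3, h4]

/-- A path of `Q^x` regarded as a path of `Q`. -/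
def gluedPath {a b : SplitVertex x} (p : Quiver.Path a b) : Quiver.Path a.proj b.proj :=
  (glue x).mapPath p

/-- The block inclusions intertwine the two actions: at each intermediate vertex, transpose times
inclusion is the identity. -/
theorem pathMatrix_splitEmbedding_mul (hr : r ≤ d x) (M : RepSpace k (splitDim d x r))
    {a b : SplitVertex x} (p : Quiver.Path a b) :
    pathMatrix (splitEmbedding d x r M) (gluedPath p) * blockIncl k d r a.proj a =
      blockIncl k d r b.proj b * pathMatrix M p := by
  induction p with
  | nil =>
    change 1 * _ = _ * 1
    rw [Matrix.one_mul, Matrix.mul_one]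
  | @cons b c p f ih =>
    calc _ = splitEmbedding d x r M b.proj c.proj f.1 *
          (pathMatrix (splitEmbedding d x r M) (gluedPath p) *
            blockIncl k d r a.proj a) := Matrix.mul_assoc _ _ _
      _ = blockIncl k d r c.proj c * M b c f * ((blockIncl k d r b.proj b).transpose *
            blockIncl k d r b.proj b) * pathMatrix M p := by
          rw [ih, splitEmbedding_arrow]
          simp only [Matrix.mul_assoc]
      _ = _ := by
          rw [transpose_blockIncl_mul hr, Matrix.mul_one, pathMatrix, Matrix.mul_assoc]

/-- The first arrow of the path already factors through the projection onto its source block. For a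
trivial path at x_h or x_t the left side would be the identity and the right side only a block
projection. -/
theorem pathMatrix_splitEmbedding (hr : r ≤ d x) (M : RepSpace k (splitDim d x r))
    {a b : SplitVertex x} (p : Quiver.Path a b) (hp : 1 ≤ p.length) :
    pathMatrix (splitEmbedding d x r M) (gluedPath p) =
      blockIncl k d r b.proj b * pathMatrix M p * (blockIncl k d r a.proj a).transpose := by
  have h : pathMatrix (splitEmbedding d x r M) (gluedPath p) *
      (blockIncl k d r a.proj a * (blockIncl k d r a.proj a).transpose) =
      pathMatrix (splitEmbedding d x r M) (gluedPath p) := by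
    induction p with
    | nil => simp at hp
    | @cons b c p f ih =>
      change splitEmbedding d x r M b.proj c.proj f.1 *
          pathMatrix (splitEmbedding d x r M) (gluedPath p) * _ =
        splitEmbedding d x r M b.proj c.proj f.1 *
          pathMatrix (splitEmbedding d x r M) (gluedPath p)
      cases p with
      | nil =>
        have h1 : pathMatrix (splitEmbedding d x r M) (gluedPath (.nil : Quiver.Path a a)) =
          1 := rfl
        rw [h1, splitEmbedding_arrow, Matrix.mul_one]
        calc _ = blockIncl k d r c.proj c * M a c f * ((blockIncl k d r a.proj a).transpose *
              blockIncl k d r a.proj a) * (blockIncl k d r a.proj a).transpose := by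
              simp only [Matrix.mul_assoc]
          _ = _ := by rw [transpose_blockIncl_mul hr, Matrix.mul_one]
      | cons p g =>
        rw [Matrix.mul_assoc, ih (by simp)]
  rw [← h, ← Matrix.mul_assoc, pathMatrix_splitEmbedding_mul hr]

end Embedding

/-! ### Gluing total spaces -/

section Gluing

variable {k : Type w} [Field k] {V : Type u} [DecidableEq V] [Fintype V] {d : V → ℕ} {x : V}
  {r : ℕ}

variable (k d x r) in
/-- The gluing map from the total space of a representation of `Q^x` to that of its image under
the block embedding. -/
noncomputable def blockGlue :
    (∀ z : SplitVertex x, Fin (splitDim d x r z) → k) →ₗ[k] (∀ z, Fin (d z) → k) :=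
  ∑ z : SplitVertex x, LinearMap.single k (fun z => Fin (d z) → k) z.proj ∘ₗ
    (blockIncl k d r z.proj z).mulVecLin ∘ₗ LinearMap.proj z

variable (k d x r) in
/-- The inverse of the gluing map. -/
noncomputable def blockUnglue :
    (∀ z, Fin (d z) → k) →ₗ[k] (∀ z : SplitVertex x, Fin (splitDim d x r z) → k) :=
  LinearMap.pi fun z => (blockIncl k d r z.proj z).transpose.mulVecLin ∘ₗ LinearMap.proj z.proj

theorem blockGlue_single (z : SplitVertex x) (v : Fin (splitDim d x r z) → k) :
    blockGlue k d x r (Pi.single z v) =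
      Pi.single z.proj ((blockIncl k d r z.proj z).mulVec v) := by
  rw [blockGlue, LinearMap.sum_apply, Finset.sum_eq_single z]
  · simp
  · intro b _ hb
    simp [hb]
  · simp

/-- Distinct split vertices have the same image only for x_t and x_h, whose blocks occupy disjoint
coordinates. -/
theorem blockUnglue_comp_blockGlue (hr : r ≤ d x) :
    blockUnglue k d x r ∘ₗ blockGlue k d x r = LinearMap.id := by
  refine LinearMap.pi_ext fun z v => funext fun z' => ?_
  simp only [LinearMap.comp_apply, blockGlue_single, blockUnglue, LinearMap.pi_apply,
    Matrix.mulVecLin_apply, LinearMap.proj_apply, LinearMap.id_apply]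
  by_cases hz : z' = z
  · subst hz
    rw [Pi.single_eq_same, Pi.single_eq_same, Matrix.mulVec_mulVec, transpose_blockIncl_mul hr,
      Matrix.one_mulVec]
  · rw [Pi.single_eq_of_ne hz]
    by_cases hp : z'.proj = z.proj
    · cases z' with
      | old y hy =>
        cases z with
        | old z h => exact absurd (proj_inj_of_ne_head (by simp) (by simp) hp) hz
        | tail => exact absurd hp hy
        | head => exact absurd hp hy
      | tail =>
        cases z with
        | old z h => exact absurd hp.symm h
        | tail => exact absurd rfl hz
        | head =>
          change (blockIncl k d r x (tail : SplitVertex x)).transpose.mulVec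
            ((Pi.single x ((blockIncl k d r x (head : SplitVertex x)).mulVec v) :
              ∀ z, Fin (d z) → k) x) = 0
          rw [Pi.single_eq_same, Matrix.mulVec_mulVec]
          rw [transpose_blockIncl_tail_mul_head, Matrix.zero_mulVec]
      | head =>
        cases z with
        | old z h => exact absurd hp.symm h
        | head => exact absurd rfl hz
        | tail =>
          change (blockIncl k d r x (head : SplitVertex x)).transpose.mulVec
            ((Pi.single x ((blockIncl k d r x (tail : SplitVertex x)).mulVec v) :
              ∀ z, Fin (d z) → k) x) = 0
          rw [Pi.single_eq_same, Matrix.mulVec_mulVec]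
          rw [transpose_blockIncl_head_mul_tail, Matrix.zero_mulVec]
    · rw [Pi.single_eq_of_ne hp, Matrix.mulVec_zero]

end Gluing

/-! ### Consequences of block form -/

section BlockForm

variable {k : Type w} [Field k] {V : Type u} [Quiver.{v} V] {d : V → ℕ} {x : V} {r : ℕ}

/-- Block form alone gives the relations at the node; membership in rep_A(d) is not presupposed, as
it is still to be proved for embedded representations. -/
theorem IsBlockForm.mul_eq_zero {N : RepSpace k d} (hN : IsBlockForm x r N) {a b : V} (f : a ⟶ x)
    (g : x ⟶ b) : N x b g * N a x f = 0 := by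
  apply Matrix.mulVec_injective
  funext v
  rw [← Matrix.mulVec_mulVec, hN.2 b g _ (hN.1 a f v), Matrix.zero_mulVec]

variable [Fintype V]

theorem mem_splitIdeal {I : TwoSidedIdeal (PathAlgebra k V)} {a : PathAlgebra k (SplitVertex x)} :
    a ∈ splitIdeal I x ↔ a ∈ radPow k (SplitVertex x) 1 ∧ glueLinear k a ∈ I :=
  TwoSidedIdeal.mem_mk' _ _ _ _ _ _ _

variable [∀ a b : V, Fintype (a ⟶ b)]

theorem range_headMap_eq_of_isBlockForm (hr : r ≤ d x) {N : RepSpace k d}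
    (hN : IsBlockForm x r N) (h : xRank x N = r) :
    LinearMap.range (headMap N x) = coordSubspace k (d x) r :=
  Submodule.eq_of_le_of_finrank_eq (range_headMap_le_iff.2 hN.1)
    (h.trans (finrank_coordSubspace hr).symm)

theorem xRank_le_of_isBlockForm (hr : r ≤ d x) {N : RepSpace k d} (hN : IsBlockForm x r N) :
    xRank x N ≤ r :=
  (Submodule.finrank_mono (range_headMap_le_iff.2 hN.1)).trans (finrank_coordSubspace hr).le

end BlockForm

/-! ### The embedded rep_{A^x} as the block-form part of rep_A(d) -/

section SplitRepresentations

variable {k : Type w} [Field k] {V : Type u} [Quiver.{v} V] [DecidableEq V] [Fintype V]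
  {I : TwoSidedIdeal (PathAlgebra k V)} {d : V → ℕ} {x : V} {r : ℕ}

theorem evalRep_splitEmbedding (hr : r ≤ d x) (M : RepSpace k (splitDim d x r))
    {a : PathAlgebra k (SplitVertex x)} (ha : a ∈ radPow k (SplitVertex x) 1) :
    evalRep (splitEmbedding d x r M) (glueLinear k a) =
      blockGlue k d x r ∘ₗ evalRep M a ∘ₗ blockUnglue k d x r := by
  induction ha using Submodule.span_induction with
  | mem a h =>
    obtain ⟨⟨a, b, p⟩, hp, rfl⟩ := h
    have h1 : glueLinear k (ofPath k ⟨a, b, p⟩) = ofPath k ⟨a.proj, b.proj, gluedPath p⟩ :=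
      lift_ofPath _ _
    rw [h1, evalRep_ofPath, evalRep_ofPath, pathMatrix_splitEmbedding hr M p hp]
    refine LinearMap.ext fun v => ?_
    simp only [LinearMap.comp_apply, LinearMap.single_apply, blockGlue_single]
    simp [blockUnglue, Matrix.mulVec_mulVec, Matrix.mul_assoc]
  | zero => simp
  | add a b _ _ h h' => simp only [map_add, h, h', LinearMap.comp_add, LinearMap.add_comp]
  | smul t a _ h => simp only [map_smul, h, LinearMap.comp_smul, LinearMap.smul_comp]

theorem mem_repVariety_of_splitEmbedding (hr : r ≤ d x) {M : RepSpace k (splitDim d x r)}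
    (hM : splitEmbedding d x r M ∈ repVariety I d) :
    M ∈ repVariety (splitIdeal I x) (splitDim d x r) := by
  intro a ha
  obtain ⟨ha, haI⟩ := mem_splitIdeal.1 ha
  have h := evalRep_splitEmbedding hr M ha
  rw [hM _ haI] at h
  refine LinearMap.ext fun v => ?_
  have h1 (v) := LinearMap.congr_fun (blockUnglue_comp_blockGlue (k := k) hr) v
  simp only [LinearMap.comp_apply, LinearMap.id_apply] at h1
  -- Ungluing the output and feeding in a glued vector cancels both outer maps and leaves `evalRep M
  -- a v`.
  have h2 := congrArg (blockUnglue k d x r) (LinearMap.congr_fun h (blockGlue k d x r v))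
  simpa [h1] using h2.symm

/-- A path of positive length is a path of the split quiver or passes through the node. -/
theorem exists_gluePath_eq_or_mem (hx : IsNode I x) {N : RepSpace k d} (hN : IsBlockForm x r N)
    {a b : V} (p : Quiver.Path a b) (hp : 1 ≤ p.length) :
    (∃ p' : AnyPath (SplitVertex x), 1 ≤ p'.2.2.length ∧ gluePath p' = ⟨a, b, p⟩) ∨
      (ofPath k ⟨a, b, p⟩ ∈ I ∧ pathMatrix N p = 0) := by
  induction p with
  | nil => simp at hp
  | @cons b c q f ih =>
    cases q with
    | nil =>
      left
      obtain ⟨a, rfl, ha⟩ := exists_proj_eq_ne_head (x := x) a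
      obtain ⟨c, rfl, hc⟩ := exists_proj_eq_ne_tail (x := x) c
      exact ⟨⟨a, c, Quiver.Path.nil.cons (⟨f, ha, hc⟩ : a ⟶ c)⟩, by simp, rfl⟩
    | @cons e _ q0 g =>
      by_cases hb : b = x
      -- The last two arrows meet at the node, so their composite, and with it the whole path, lies
      -- in I.
      · subst hb
        right
        refine ⟨?_, ?_⟩
        · have h := I.mul_mem_right _ (ofPath k ⟨a, e, q0⟩) (hx e c g f)
          rw [ofPath_mul_ofPath, pathMul_comp] at h
          exact h
        · rw [pathMatrix, pathMatrix, ← Matrix.mul_assoc, hN.mul_eq_zero, Matrix.zero_mul]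
      · obtain ⟨⟨a', b', p'⟩, hp', h⟩ | ⟨h1, h2⟩ := ih (by simp)
        · left
          generalize q0.cons g = q at h
          cases h
          obtain ⟨c, rfl, hc⟩ := exists_proj_eq_ne_tail (x := x) c
          -- The lifted path must end where an arrow can leave, i.e. not at x_h; this holds because
          -- b ≠ x.
          have hb' : b' ≠ head := by
            rintro rfl
            exact hb rfl
          exact ⟨⟨a', c, p'.cons (⟨f, hb', hc⟩ : b' ⟶ c)⟩, by simp, rfl⟩
        · right
          refine ⟨?_, ?_⟩
          · have h := I.mul_mem_left (ofPath k ⟨b, c, f.toPath⟩) _ h1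
            rw [ofPath_mul_ofPath, pathMul_comp] at h
            exact h
          · rw [pathMatrix, h2, Matrix.mul_zero]

/-- Modulo paths through the node, rad(kQ) comes from rad(kQ^x). The error lies in I, but N need not
be in rep_A(d), so its zero action on N is recorded separately. -/
theorem exists_splitEmbedding_sub_mem (hx : IsNode I x) {N : RepSpace k d}
    (hN : IsBlockForm x r N) {a : PathAlgebra k V} (ha : a ∈ radPow k V 1) :
    ∃ a' ∈ radPow k (SplitVertex x) 1, a - glueLinear k a' ∈ I ∧
      evalRep N (a - glueLinear k a') = 0 := by
  induction ha using Submodule.span_induction with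
  | mem a h =>
    obtain ⟨⟨a, b, p⟩, hp, rfl⟩ := h
    obtain ⟨p', hp', h⟩ | ⟨h1, h2⟩ := exists_gluePath_eq_or_mem hx hN p hp
    · refine ⟨ofPath k p', Submodule.subset_span ⟨p', hp', rfl⟩, ?_⟩
      have h1 : glueLinear k (ofPath k p') = ofPath k ⟨a, b, p⟩ := by
        rw [← h]
        exact lift_ofPath _ _
      rw [h1, sub_self]
      exact ⟨I.zero_mem, map_zero _⟩
    · refine ⟨0, Submodule.zero_mem _, ?_⟩
      rw [map_zero, sub_zero]
      exact ⟨h1, (evalRep_ofPath_eq_zero_iff N p).2 h2⟩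
  | zero => exact ⟨0, Submodule.zero_mem _, by simp [I.zero_mem]⟩
  | add a b _ _ h h' =>
    obtain ⟨a', ha', h1, h2⟩ := h
    obtain ⟨b', hb', h3, h4⟩ := h'
    refine ⟨a' + b', Submodule.add_mem _ ha' hb', ?_⟩
    rw [map_add, add_sub_add_comm, map_add, h2, h4]
    exact ⟨I.add_mem h1 h3, add_zero _⟩
  | smul t a _ h =>
    obtain ⟨a', ha', h1, h2⟩ := h
    refine ⟨t • a', Submodule.smul_mem _ t ha', ?_⟩
    rw [map_smul, ← smul_sub, map_smul, h2]
    exact ⟨smul_mem_ideal I t h1, smul_zero _⟩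

theorem splitEmbedding_mem_repVariety (hr : r ≤ d x) (hx : IsNode I x)
    (hI : ∀ a ∈ I, a ∈ radPow k V 1) {M : RepSpace k (splitDim d x r)}
    (hM : M ∈ repVariety (splitIdeal I x) (splitDim d x r)) :
    splitEmbedding d x r M ∈ repVariety I d := by
  intro a ha
  obtain ⟨a', ha', h1, h2⟩ :=
    exists_splitEmbedding_sub_mem hx (isBlockForm_splitEmbedding M) (hI a ha)
  -- Both a and the error lie in I, so a' lies in I^x and kills M.
  have h3 : glueLinear k a' ∈ I := by
    have h := I.sub_mem ha h1
    rwa [sub_sub_cancel] at h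
  have h4 := evalRep_splitEmbedding hr M ha'
  rw [hM a' (mem_splitIdeal.2 ⟨ha', h3⟩)] at h4
  rw [map_sub, h4] at h2
  simpa using h2

theorem mem_splitRepVariety_iff (hr : r ≤ d x) (hx : IsNode I x)
    (hI : ∀ a ∈ I, a ∈ radPow k V 1) {N : RepSpace k d} :
    N ∈ splitRepVariety I d x r ↔ N ∈ repVariety I d ∧ IsBlockForm x r N := by
  constructor
  · rintro ⟨M, hM, rfl⟩
    exact ⟨splitEmbedding_mem_repVariety hr hx hI hM, isBlockForm_splitEmbedding M⟩
  · rintro ⟨h1, h2⟩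
    obtain ⟨M, rfl⟩ := exists_splitEmbedding_eq hr h2
    exact ⟨M, mem_repVariety_of_splitEmbedding hr h1, rfl⟩

variable [∀ a b : V, Fintype (a ⟶ b)]

/-- The node relations say that each arrow out of x kills the image of every arrow into x, hence all
of im h_x(N). -/
theorem isBlockForm_of_range_headMap (hx : IsNode I x) {N : RepSpace k d}
    (hN : N ∈ repVariety I d)
    (h : LinearMap.range (headMap N x) = coordSubspace k (d x) r) : IsBlockForm x r N := by
  refine ⟨fun a f v => h ▸ mulVec_mem_range_headMap N f v, fun b g => ?_⟩
  have h1 : LinearMap.range (headMap N x) ≤ LinearMap.ker (N x b g).mulVecLin := by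
    refine range_headMap_le_iff.2 fun a f v => ?_
    simp [Matrix.mulVec_mulVec, mul_eq_zero_of_isNode hx hN f g]
  rw [h] at h1
  exact fun v hv => h1 hv

end SplitRepresentations

/-! ### Transitivity of GL on subspaces of a given dimension -/

section Subspaces

variable {k : Type w} [Field k]

theorem exists_linearEquiv_map_eq {E : Type*} [AddCommGroup E] [Module k E]
    [FiniteDimensional k E] {U U' : Submodule k E}
    (h : Module.finrank k U = Module.finrank k U') : ∃ e : E ≃ₗ[k] E, U.map e.toLinearMap = U' := by
  obtain ⟨C, hC⟩ := U.exists_isCompl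
  obtain ⟨C', hC'⟩ := U'.exists_isCompl
  have h1 := Submodule.finrank_add_eq_of_isCompl hC
  have h2 := Submodule.finrank_add_eq_of_isCompl hC'
  let e1 := LinearEquiv.ofFinrankEq U U' h
  let e2 := LinearEquiv.ofFinrankEq (R := k) C C' (by omega)
  let e := (Submodule.prodEquivOfIsCompl U C hC).symm ≪≫ₗ e1.prodCongr e2 ≪≫ₗ
    Submodule.prodEquivOfIsCompl U' C' hC'
  refine ⟨e, Submodule.eq_of_le_of_finrank_eq ?_ ?_⟩
  · rintro _ ⟨v, hv, rfl⟩
    have h3 : (Submodule.prodEquivOfIsCompl U C hC).symm v = (⟨v, hv⟩, 0) := by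
      simpa using Submodule.prodEquivOfIsCompl_symm_apply_left U C hC ⟨v, hv⟩
    simp [e, h3]
  · rw [← h]
    exact LinearEquiv.finrank_map_eq e U

theorem exists_map_coordSubspace_eq {n r : ℕ} (hr : r ≤ n) {U : Submodule k (Fin n → k)}
    (hU : Module.finrank k U = r) :
    ∃ g : GL (Fin n) k, (coordSubspace k n r).map g.val.mulVecLin = U := by
  obtain ⟨e, he⟩ := exists_linearEquiv_map_eq ((finrank_coordSubspace (k := k) hr).trans hU.symm)
  refine ⟨⟨LinearMap.toMatrix' e.toLinearMap, LinearMap.toMatrix' e.symm.toLinearMap, ?_, ?_⟩, ?_⟩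
  · rw [← LinearMap.toMatrix'_comp]
    simp
  · rw [← LinearMap.toMatrix'_comp]
    simp
  · rw [← he]
    congr 1
    exact Matrix.toLin'_toMatrix' _

end Subspaces

/-! ### Closed conditions, semicontinuity of rank, and local frames -/

section Polynomials

variable {k : Type w} [Field k]

theorem mulVec_mem {T : Type*} {R : Subalgebra k (T → k)} {m n : Type*} [Fintype n]
    {A : T → Matrix m n k} (hA : ∀ i j, (fun t => A t i j) ∈ R) (v : n → k) (i : m) :
    (fun t => (A t).mulVec v i) ∈ R := by
  have h : (fun t => (A t).mulVec v i) = ∑ j, (fun t => A t i j) * fun _ => v j := by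
    funext t
    simp [Matrix.mulVec, dotProduct]
  rw [h]
  exact sum_mem fun j _ => mul_mem (hA i j) (const_mem _)

variable {V : Type u} [Quiver.{v} V] {d : V → ℕ}

theorem IsRegularMap.rep_entry {T : Type*} {R : Subalgebra k (T → k)} {φ : T → RepSpace k d}
    (hφ : IsRegularMap R φ) {a b : V} (f : a ⟶ b) (i : Fin (d b)) (j : Fin (d a)) :
    (fun t => φ t a b f i j) ∈ R :=
  hφ
    { toFun := fun M => M a b f i j
      map_add' := fun _ _ => rfl
      map_smul' := fun _ _ => rfl }

theorem isRegularMap_rep [Finite V] [∀ a b : V, Finite (a ⟶ b)] {T : Type*}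
    {R : Subalgebra k (T → k)} {φ : T → RepSpace k d}
    (h : ∀ (a b : V) (f : a ⟶ b) i j, (fun t => φ t a b f i j) ∈ R) : IsRegularMap R φ :=
  isRegularMap_pi fun a => isRegularMap_pi fun b => isRegularMap_pi fun f =>
    isRegularMap_matrix (h a b f)

theorem pathMatrix_mem_polyFun {a b : V} (p : Quiver.Path a b) : ∀ (i : Fin (d b)) (j : Fin (d a)),
    (fun M : RepSpace k d => pathMatrix M p i j) ∈ polyFun k (RepSpace k d) := by
  induction p with
  | nil => exact fun i j => const_mem ((1 : Matrix (Fin (d a)) (Fin (d a)) k) i j)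
  | cons p f ih => exact mul_entry_mem (isRegularMap_id.rep_entry f) ih

theorem evalRep_mem_polyFun [DecidableEq V] (a : PathAlgebra k V) (v : ∀ z, Fin (d z) → k) (z : V)
    (i : Fin (d z)) :
    (fun M : RepSpace k d => evalRep M a v z i) ∈ polyFun k (RepSpace k d) := by
  induction a using elemInduction with
  | zero => simpa using const_mem 0
  | add a b ha hb =>
    simp only [map_add]
    exact add_mem ha hb
  | smul t p =>
    obtain ⟨a, b, p⟩ := p
    have h : (fun M : RepSpace k d => evalRep M (t • ofPath k ⟨a, b, p⟩) v z i) =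
        t • fun M : RepSpace k d => evalRep M (ofPath k ⟨a, b, p⟩) v z i := by
      funext M
      simp
    rw [h]
    refine Subalgebra.smul_mem _ ?_ t
    simp only [evalRep_ofPath]
    by_cases hz : z = b
    · subst hz
      simpa using mulVec_mem (pathMatrix_mem_polyFun p) (v a) i
    · simpa [hz] using const_mem 0

theorem isClosed_repVariety [DecidableEq V] [Fintype V] (I : TwoSidedIdeal (PathAlgebra k V))
    (d : V → ℕ) : @IsClosed _ (zariski k (RepSpace k d)) (repVariety I d) := by
  let _ := zariski k (RepSpace k d)
  have h : repVariety I d = ⋂ (a ∈ I) (v : ∀ z, Fin (d z) → k) (z : V) (i : Fin (d z)),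
      {M : RepSpace k d | evalRep M a v z i = 0} := by
    ext M
    simp only [repVariety, Set.mem_iInter, Set.mem_ofPred_eq, LinearMap.ext_iff, funext_iff]
    rfl
  rw [h]
  exact isClosed_biInter fun a _ => isClosed_iInter fun v => isClosed_iInter fun z =>
    isClosed_iInter fun i => isClosed_zariski_eq_zero (evalRep_mem_polyFun a v z i)

theorem isClosed_isBlockForm (x : V) (r : ℕ) :
    @IsClosed _ (zariski k (RepSpace k d)) {N | IsBlockForm x r N} := by
  let _ := zariski k (RepSpace k d)
  have h : {N : RepSpace k d | IsBlockForm x r N} =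
      (⋂ (a : V) (f : a ⟶ x) (v : Fin (d a) → k) (i : Fin (d x)) (_ : r ≤ i.val),
        {N : RepSpace k d | (N a x f).mulVec v i = 0}) ∩
      ⋂ (b : V) (f : x ⟶ b) (v ∈ coordSubspace k (d x) r) (i : Fin (d b)),
        {N : RepSpace k d | (N x b f).mulVec v i = 0} := by
    ext N
    simp only [IsBlockForm, Set.mem_inter_iff, Set.mem_iInter, Set.mem_ofPred_eq, funext_iff,
      mem_coordSubspace]
    rfl
  rw [h]
  refine IsClosed.inter ?_ ?_
  · exact isClosed_iInter fun a => isClosed_iInter fun f => isClosed_iInter fun v =>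
      isClosed_iInter fun i => isClosed_iInter fun _ =>
        isClosed_zariski_eq_zero (mulVec_mem (isRegularMap_id.rep_entry f) v i)
  · exact isClosed_iInter fun a => isClosed_iInter fun f => isClosed_iInter fun v =>
      isClosed_iInter fun _ => isClosed_iInter fun i =>
        isClosed_zariski_eq_zero (mulVec_mem (isRegularMap_id.rep_entry f) v i)

variable [Fintype V] [∀ a b : V, Fintype (a ⟶ b)]

theorem isRegularMap_headMap {T : Type*} {R : Subalgebra k (T → k)} {φ : T → RepSpace k d}
    (hφ : IsRegularMap R φ) (x : V) (v : ∀ α : Σ a : V, (a ⟶ x), Fin (d α.1) → k) :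
    IsRegularMap R fun t => headMap (φ t) x v := by
  refine isRegularMap_pi fun i => isRegularMap_of_mem ?_
  have h : (fun t => headMap (φ t) x v i) =
      ∑ α : Σ a : V, (a ⟶ x), fun t => (φ t α.1 x α.2).mulVec (v α) i := by
    funext t
    simp [headMap_apply]
  rw [h]
  exact sum_mem fun α _ => mulVec_mem (hφ.rep_entry α.2) (v α) i

/-- Rank is lower semicontinuous. Fix inputs whose images at N are s independent vectors; they stay
independent wherever a suitable s × s determinant, polynomial in M, is non-zero. -/
theorem isOpen_le_xRank (x : V) (s : ℕ) :
    @IsOpen _ (zariski k (RepSpace k d)) {M | s ≤ xRank x M} := by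
  let _ := zariski k (RepSpace k d)
  refine isOpen_iff_forall_mem_open.2 fun N hN => ?_
  obtain ⟨u, hu⟩ := exists_linearIndependent_of_le_finrank
    (show s ≤ Module.finrank k (LinearMap.range (headMap N x)) from hN)
  choose b hb using fun j => (u j).2
  have hu' : LinearIndependent k fun j => headMap N x (b j) := by
    simp only [hb]
    exact hu.map' _ (Submodule.ker_subtype _)
  -- A left inverse of the frame at N replaces the choice of a minor: it makes D(N) the identity
  -- matrix.
  obtain ⟨L, hL⟩ := LinearMap.exists_leftInverse_of_injective
    (Fintype.linearCombination k fun j => headMap N x (b j))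
    (LinearMap.ker_eq_bot.2 (linearIndependent_iff_injective_fintypeLinearCombination.1 hu'))
  let D (M : RepSpace k d) : Matrix (Fin s) (Fin s) k :=
    Matrix.of fun i j => L (headMap M x (b j)) i
  have hD : (fun M => (D M).det) ∈ polyFun k (RepSpace k d) :=
    det_mem fun i j => (isRegularMap_headMap isRegularMap_id x (b j)).comp_linear
      (LinearMap.proj i ∘ₗ L) |>.mem
  refine ⟨{M | (D M).det ≠ 0}, fun M hM => ?_, isOpen_zariski_ne_zero hD, ?_⟩
  · have h1 : LinearIndependent k fun j => headMap M x (b j) :=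
      LinearIndependent.of_comp L (Matrix.linearIndependent_cols_of_det_ne_zero hM)
    have h2 := finrank_span_eq_card h1
    rw [Fintype.card_fin] at h2
    refine h2.symm.le.trans (Submodule.finrank_mono (Submodule.span_le.2 ?_))
    rintro _ ⟨j, rfl⟩
    exact ⟨_, rfl⟩
  · have h1 : D N = 1 := by
      ext i j
      have h2 := congrFun (LinearMap.congr_fun hL (Pi.single j 1)) i
      simp only [LinearMap.comp_apply, Fintype.linearCombination_apply_single, one_smul,
        LinearMap.id_apply] at h2
      change L (headMap N x (b j)) i = _
      rw [h2, Matrix.one_apply, Pi.single_apply]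
    simp [h1]

theorem isZariskiLocallyClosed_xRank_eq {S : Set (RepSpace k d)}
    (hS : @IsClosed _ (zariski k (RepSpace k d)) S) (x : V) (s : ℕ) :
    IsZariskiLocallyClosed k {M | M ∈ S ∧ xRank x M = s} := by
  let _ := zariski k (RepSpace k d)
  refine ⟨{M | s ≤ xRank x M}, S ∩ {M | s + 1 ≤ xRank x M}ᶜ, isOpen_le_xRank x s,
    hS.inter (isOpen_le_xRank x _).isClosed_compl, ?_⟩
  ext M
  simp only [Set.mem_ofPred_eq, Set.mem_inter_iff, Set.mem_compl_iff]
  constructor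
  · rintro ⟨h1, h2⟩
    exact ⟨h2.ge, h1, by omega⟩
  · rintro ⟨h1, h2, h3⟩
    exact ⟨h2, by omega⟩

/-- Near a point `N₀` of the rank stratum, a frame whose first `r` vectors span the image of the
arrows into `x` depends polynomially on the representation. -/
theorem exists_local_frame {x : V} {r : ℕ} {N₀ : RepSpace k d} {g₀ : GL (Fin (d x)) k}
    (hg₀ : (coordSubspace k (d x) r).map g₀.val.mulVecLin = LinearMap.range (headMap N₀ x)) :
    ∃ G : RepSpace k d → Matrix (Fin (d x)) (Fin (d x)) k,
      (∀ i j, (fun N => G N i j) ∈ polyFun k (RepSpace k d)) ∧ (G N₀).det ≠ 0 ∧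
      ∀ N, (coordSubspace k (d x) r).map (G N).mulVecLin ≤ LinearMap.range (headMap N x) := by
  have hb (j : Fin (d x)) : ∃ v, j.val < r → headMap N₀ x v = g₀.val.mulVec (Pi.single j 1) := by
    by_cases hj : j.val < r
    · have h : g₀.val.mulVec (Pi.single j 1) ∈ LinearMap.range (headMap N₀ x) := by
        rw [← hg₀]
        refine ⟨_, mem_coordSubspace.2 fun l hl => ?_, rfl⟩
        rw [Pi.single_eq_of_ne]
        rintro rfl
        omega
      obtain ⟨v, hv⟩ := h
      exact ⟨v, fun _ => hv⟩
    · exact ⟨0, fun h => absurd h hj⟩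
  choose b hb using hb
  -- The first r columns follow N through fixed inputs b_j; the others stay those of g₀. At N₀ this
  -- gives back g₀.
  refine ⟨fun N => Matrix.of fun i j => if j.val < r then headMap N x (b j) i else g₀.val i j,
    fun i j => ?_, ?_, fun N => ?_⟩
  · by_cases hj : j.val < r
    · simpa [hj] using (isRegularMap_headMap (isRegularMap_id (k := k)) x (b j)).comp_linear
        (LinearMap.proj i) |>.mem
    · simpa [hj] using const_mem _
  · have h : (Matrix.of fun i j => if j.val < r then headMap N₀ x (b j) i else g₀.val i j) =
        g₀.val := by
      ext i j
      by_cases hj : j.val < r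
      · simp [hj, hb j hj]
      · simp [hj]
    simp only [h]
    exact ((Matrix.isUnit_iff_isUnit_det _).1 g₀.isUnit).ne_zero
  · rintro _ ⟨v, hv, rfl⟩
    -- For v in E_r the coefficients of the frozen columns vanish, so only columns in im h_x(N)
    -- contribute.
    refine ⟨∑ j, v j • b j, ?_⟩
    funext i
    simp only [map_sum, map_smul, Finset.sum_apply, Matrix.mulVecLin_apply, Matrix.mulVec,
      dotProduct, Matrix.of_apply, Pi.smul_apply, smul_eq_mul]
    refine Finset.sum_congr rfl fun j _ => ?_
    by_cases hj : j.val < r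
    · simp [hj, mul_comm]
    · simp [mem_coordSubspace.1 hv j (not_lt.1 hj)]

end Polynomials

/-! ### The homogeneous fiber bundle and its inverse map -/

section Bundle

variable {k : Type w} [Field k] {V : Type u} [Quiver.{v} V] [DecidableEq V] {d : V → ℕ} {x : V}

theorem isRegularMap_vertexAct [Finite V] [∀ a b : V, Finite (a ⟶ b)] {T : Type*}
    {R : Subalgebra k (T → k)} {g : T → GL (Fin (d x)) k} {φ : T → RepSpace k d}
    (hg : ∀ i j, (fun t => (g t).val i j) ∈ R) (hg' : ∀ i j, (fun t => (g t)⁻¹.val i j) ∈ R)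
    (hφ : IsRegularMap R φ) : IsRegularMap R fun t => vertexAct x (g t) (φ t) := by
  have h (h : T → GL (Fin (d x)) k) (hh : ∀ i j, (fun t => (h t).val i j) ∈ R) (z : V) (i j) :
      (fun t => (Pi.mulSingle x (h t) : ∀ z, GL (Fin (d z)) k) z |>.val i j) ∈ R := by
    by_cases hz : z = x
    · subst hz
      simpa using hh i j
    · simpa [hz] using const_mem _
  refine isRegularMap_rep fun a b f => ?_
  have hinv (t) : ((Pi.mulSingle x (g t) : ∀ z, GL (Fin (d z)) k) a)⁻¹ =
      (Pi.mulSingle x (g t)⁻¹ : ∀ z, GL (Fin (d z)) k) a := by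
    rw [Pi.mulSingle_inv, Pi.inv_apply]
  simp only [vertexAct, baseChange, hinv]
  exact mul_entry_mem (mul_entry_mem (h g hg b) (hφ.rep_entry f)) (h _ hg' a)

theorem coe_inv_mem_regularFun {T : Type*} {W : Type*} [AddCommGroup W] [Module k W] {ι : T → W}
    {n : ℕ} {g : T → GL (Fin n) k} (hg : ∀ i j, (fun t => (g t).val i j) ∈ regularFun ι)
    (i j : Fin n) : (fun t => (g t)⁻¹.val i j) ∈ regularFun ι := by
  simp only [Matrix.coe_units_inv]
  refine inv_entry_mem hg (inv_mem_regularFun (det_mem hg) fun t => ?_) i j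
  exact ((Matrix.isUnit_iff_isUnit_det _).1 (g t).isUnit).ne_zero

variable [Fintype V] [∀ a b : V, Fintype (a ⟶ b)] {I : TwoSidedIdeal (PathAlgebra k V)} {r : ℕ}

theorem vertexAct_mem_rankStratum (g : GL (Fin (d x)) k) {N : RepSpace k d}
    (hN : N ∈ rankStratum I d x r) : vertexAct x g N ∈ rankStratum I d x r :=
  ⟨vertexAct_mem_repVariety g hN.1, (xRank_vertexAct x g N).trans hN.2⟩

variable {S : Set (RepSpace k d)}

/-- If gM = g'M', then g'⁻¹g carries im h_x(M) = E_r onto im h_x(M') = E_r, so it lies in P_r. This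
gives injectivity of Ψ and independence of choices for its inverse. -/
theorem bundleMk_eq_of_vertexAct_eq
    (hS : ∀ N ∈ S, LinearMap.range (headMap N x) = coordSubspace k (d x) r)
    {g g' : GL (Fin (d x)) k} {M M' : S} (h : vertexAct x g M.1 = vertexAct x g' M'.1) :
    bundleMk (parabolic k (d x) r) g M = bundleMk (parabolic k (d x) r) g' M' := by
  have h1 : vertexAct x (g'⁻¹ * g) M.1 = M'.1 := by
    rw [vertexAct_mul, h, vertexAct_inv_apply]
  refine Quotient.sound ⟨g'⁻¹ * g, ?_, by simp, h1.symm⟩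
  refine mem_parabolic_iff.2 fun v hv => ?_
  rw [← hS _ M.2] at hv
  rw [← hS _ M'.2, ← h1, range_headMap_vertexAct]
  exact ⟨v, hv, rfl⟩

/-- The homogeneous fiber bundle over the rank stratum. -/
theorem exists_isIsomorphism_bundle (hr : r ≤ d x)
    (hS : ∀ N, N ∈ S ↔ N ∈ repVariety I d ∧
      LinearMap.range (headMap N x) = coordSubspace k (d x) r) :
    ∃ Ψ : (bundle x (parabolic k (d x) r) S).carrier → rankStratum I d x r,
      (∀ (g : GL (Fin (d x)) k) (M : S),
        (Ψ (bundleMk (parabolic k (d x) r) g M) : RepSpace k d) = vertexAct x g M) ∧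
      IsIsomorphism (bundle x (parabolic k (d x) r) S)
        (subvariety (k := k) (Subtype.val : rankStratum I d x r → RepSpace k d)) Ψ := by
  have hSr (N) (hN : N ∈ S) : N ∈ rankStratum I d x r :=
    ⟨((hS N).1 hN).1, by rw [xRank, ((hS N).1 hN).2, finrank_coordSubspace hr]⟩
  have hfin (g : GL (Fin (d x)) k) :
      Module.finrank k ((coordSubspace k (d x) r).map g.val.mulVecLin) = r :=
    (Submodule.equivMapOfInjective g.val.mulVecLin
      (Matrix.mulVec_injective_iff_isUnit.2 g.isUnit) _).finrank_eq.symm.trans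
        (finrank_coordSubspace hr)
  have hmem (N) (hN : N ∈ rankStratum I d x r) (g : GL (Fin (d x)) k)
      (hg : (coordSubspace k (d x) r).map g.val.mulVecLin = LinearMap.range (headMap N x)) :
      vertexAct x g⁻¹ N ∈ S := by
    refine (hS _).2 ⟨vertexAct_mem_repVariety _ hN.1, ?_⟩
    rw [range_headMap_vertexAct, ← hg, ← Submodule.map_comp, ← Matrix.mulVecLin_mul,
      Units.inv_mul, Matrix.mulVecLin_one, Submodule.map_id]
  let Φ (u : GL (Fin (d x)) k × S) : rankStratum I d x r :=
    ⟨vertexAct x u.1 u.2, vertexAct_mem_rankStratum _ (hSr _ u.2.2)⟩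
  let Ψ : (bundle x (parabolic k (d x) r) S).carrier → rankStratum I d x r :=
    Quotient.lift Φ (by
      rintro u u' ⟨p, -, h1, h2⟩
      refine Subtype.ext ?_
      simp only [Φ]
      rw [h1, h2, ← vertexAct_mul, inv_mul_cancel_right])
  have hΨ (g : GL (Fin (d x)) k) (M : S) :
      (Ψ (bundleMk (parabolic k (d x) r) g M) : RepSpace k d) = vertexAct x g M := rfl
  have hex (N : rankStratum I d x r) := exists_map_coordSubspace_eq hr N.2.2
  -- The choice has no continuity; `hψ` shows that any other g gives the same class, so local
  -- sections may replace γ.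
  choose γ hγ using hex
  let ψ (N : rankStratum I d x r) : (bundle x (parabolic k (d x) r) S).carrier :=
    bundleMk (parabolic k (d x) r) (γ N) ⟨vertexAct x (γ N)⁻¹ N.1, hmem N.1 N.2 _ (hγ N)⟩
  have hψ (N : rankStratum I d x r) (g : GL (Fin (d x)) k) (M : S) (h : vertexAct x g M.1 = N.1) :
      ψ N = bundleMk (parabolic k (d x) r) g M :=
    bundleMk_eq_of_vertexAct_eq (fun N hN => ((hS N).1 hN).2)
      ((vertexAct_apply_inv _ _).trans h.symm)
  refine ⟨Ψ, hΨ, ?_, ψ, ?_, ?_, ?_⟩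
  · have hreg := isRegularMap_subvariety (k := k)
      fun u : GL (Fin (d x)) k × S => (u.1.val, u.2.val)
    have h1 : ∀ i j, (fun u : GL (Fin (d x)) k × S => u.1.val i j) ∈ regularFun (k := k)
        fun u : GL (Fin (d x)) k × S => (u.1.val, u.2.val) :=
      (hreg.comp_linear (LinearMap.fst k _ _)).entry
    exact isMorphism_of_quotient (isMorphism_of_isRegularMap
      (isRegularMap_vertexAct h1 (coe_inv_mem_regularFun h1)
        (hreg.comp_linear (LinearMap.snd k _ _))))
  · refine isMorphism_of_locally fun N₀ => ?_
    -- Where det G(N) ≠ 0, the inclusion `hle` is an equality because both sides have dimension r.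
    -- So N ↦ (G(N), G(N)⁻¹N) is a regular local lift of ψ to GL × S.
    obtain ⟨G, hG, h0, hle⟩ := exists_local_frame (hγ N₀)
    refine ⟨{N | (G N.1).det ≠ 0}, isOpen_induced_ne_zero _ (det_mem hG), h0, ?_⟩
    let U : Set (rankStratum I d x r) := {N | (G N.1).det ≠ 0}
    let g (N : U) : GL (Fin (d x)) k := Matrix.GeneralLinearGroup.mkOfDetNeZero (G N.1.1) N.2
    have hg (N : U) : (coordSubspace k (d x) r).map (g N).val.mulVecLin =
        LinearMap.range (headMap N.1.1 x) :=
      Submodule.eq_of_le_of_finrank_eq (hle N.1.1) ((hfin (g N)).trans N.1.2.2.symm)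
    let σ (N : U) : GL (Fin (d x)) k × S :=
      (g N, ⟨vertexAct x (g N)⁻¹ N.1.1, hmem _ N.1.2 _ (hg N)⟩)
    have hσ : (fun N : U => ψ N.1) =
        fun N : U => Quotient.mk (bundleSetoid x (parabolic k (d x) r) S) (σ N) :=
      funext fun N => hψ N.1 (g N) _ (vertexAct_apply_inv _ _)
    change IsMorphism (subvariety (k := k) fun N : U => N.1.1) _ fun N : U => ψ N.1
    rw [hσ]
    have hreg := isRegularMap_subvariety (k := k) fun N : U => N.1.1
    have h1 (i j) : (fun N : U => (g N).val i j) ∈ regularFun (k := k) fun N : U => N.1.1 :=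
      polyFun_comp_mem_regularFun (hG i j)
    have h2 := coe_inv_mem_regularFun h1
    have h3 : IsMorphism (subvariety (k := k) fun N : U => N.1.1) (prodSpace x S) σ :=
      isMorphism_of_isRegularMap (isRegularMap_prod (isRegularMap_matrix h1)
        (isRegularMap_vertexAct h2 (by simpa using h1) hreg))
    exact (isMorphism_quotientMk (prodSpace x S) _).comp h3
  · intro y
    induction y using Quotient.inductionOn with
    | h u => exact hψ _ u.1 u.2 rfl
  · intro N
    exact Subtype.ext (vertexAct_apply_inv _ _)

/-- Block form bounds the x-rank by r, and a point of the stratum moved into S attains it; without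
such a point the maximum would be smaller. Rank r inside E_r then forces im h_x = E_r. -/
theorem mem_maxRankLocus_iff (hr : r ≤ d x) (hx : IsNode I x)
    (hI : ∀ a ∈ I, a ∈ radPow k V 1) (hne : (rankStratum I d x r).Nonempty) (N : RepSpace k d) :
    N ∈ maxRankLocus x (splitRepVariety I d x r) ↔ N ∈ repVariety I d ∧
      LinearMap.range (headMap N x) = coordSubspace k (d x) r := by
  have hmem (N : RepSpace k d) (h1 : N ∈ repVariety I d)
      (h2 : LinearMap.range (headMap N x) = coordSubspace k (d x) r) :
      N ∈ splitRepVariety I d x r ∧ xRank x N = r :=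
    ⟨(mem_splitRepVariety_iff hr hx hI).2 ⟨h1, isBlockForm_of_range_headMap hx h1 h2⟩,
      by rw [xRank, h2, finrank_coordSubspace hr]⟩
  have hsup : xRankSet x (splitRepVariety I d x r) = r := by
    refine IsGreatest.csSup_eq ⟨?_, ?_⟩
    · obtain ⟨N, hN⟩ := hne
      obtain ⟨g, hg⟩ := exists_map_coordSubspace_eq hr hN.2
      refine ⟨vertexAct x g⁻¹ N, hmem _ (vertexAct_mem_repVariety _ hN.1) ?_⟩
      rw [range_headMap_vertexAct, ← hg, ← Submodule.map_comp, ← Matrix.mulVecLin_mul,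
        Units.inv_mul, Matrix.mulVecLin_one, Submodule.map_id]
    · rintro _ ⟨N, hN, rfl⟩
      exact xRank_le_of_isBlockForm hr ((mem_splitRepVariety_iff hr hx hI).1 hN).2
  constructor
  · rintro ⟨h1, h2⟩
    obtain ⟨h3, h4⟩ := (mem_splitRepVariety_iff hr hx hI).1 h1
    exact ⟨h3, range_headMap_eq_of_isBlockForm hr h4 (h2.trans hsup)⟩
  · rintro ⟨h1, h2⟩
    exact ⟨(hmem N h1 h2).1, (hmem N h1 h2).2.trans hsup.symm⟩

end Bundle

end NodeSplitting

theorem mainTheorem8 {k : Type w} [Field k] [IsAlgClosed k]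
    {V : Type u} [Fintype V] [DecidableEq V] [Quiver.{v} V] [∀ a b : V, Fintype (a ⟶ b)]
    (I : TwoSidedIdeal (PathAlgebra k V)) (hI : ∀ a ∈ I, a ∈ radPow k V 2)
    (x : V) (hx : IsNode I x) (d : V → ℕ) (r : ℕ) (hr : r ≤ d x) :
    IsZariskiLocallyClosed k (rankStratum I d x r) ∧
    IsZariskiLocallyClosed k (maxRankLocus x (splitRepVariety I d x r)) ∧
    (∀ p ∈ parabolic k (d x) r, ∀ M ∈ maxRankLocus x (splitRepVariety I d x r),
      vertexAct x p M ∈ maxRankLocus x (splitRepVariety I d x r)) ∧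
    ((rankStratum I d x r).Nonempty →
      ∃ Ψ : (bundle x (parabolic k (d x) r) (maxRankLocus x (splitRepVariety I d x r))).carrier →
          rankStratum I d x r,
        (∀ (g : GL (Fin (d x)) k) (M : maxRankLocus x (splitRepVariety I d x r)),
          (Ψ (bundleMk (parabolic k (d x) r) g M) : RepSpace k d) = vertexAct x g M) ∧
        IsIsomorphism
          (bundle x (parabolic k (d x) r) (maxRankLocus x (splitRepVariety I d x r)))
          (subvariety (k := k) (Subtype.val : rankStratum I d x r → RepSpace k d)) Ψ) := by

  have hI' (a) (ha : a ∈ I) : a ∈ radPow k V 1 := by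
    refine Submodule.span_mono ?_ (hI a ha)
    rintro _ ⟨p, hp, rfl⟩
    exact ⟨p, by omega, rfl⟩
  -- The second locus is treated with its maximal rank as an unspecified constant, so non-emptiness
  -- of the stratum enters only for Ψ.
  refine ⟨isZariskiLocallyClosed_xRank_eq (isClosed_repVariety I d) x r,
    isZariskiLocallyClosed_xRank_eq ?_ x _, ?_, fun hne =>
      exists_isIsomorphism_bundle hr (mem_maxRankLocus_iff hr hx hI' hne)⟩
  · let _ := zariski k (RepSpace k d)
    have h : splitRepVariety I d x r = repVariety I d ∩ {N | IsBlockForm x r N} :=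
      Set.ext fun N => mem_splitRepVariety_iff hr hx hI'
    rw [h]
    exact (isClosed_repVariety I d).inter (isClosed_isBlockForm x r)
  · rintro p hp M ⟨h1, h2⟩
    obtain ⟨h3, h4⟩ := (mem_splitRepVariety_iff hr hx hI').1 h1
    exact ⟨(mem_splitRepVariety_iff hr hx hI').2 ⟨vertexAct_mem_repVariety p h3, h4.vertexAct hp⟩,
      (xRank_vertexAct x p M).trans h2⟩
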